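/- Let $n$ be the number of vertices, $V$ the vertex set, $|V|=n$. A topological order of a directed acyclic graph (DAG) on $V$ is a bijection $T:V\to\{1,\dots,n\}$ with $T(u)<T(v)$ for every edge $u\to v$. With respect to the current order $T$ write $u<v$ for $T(u)<T(v)$ and $d(u,v)=|T(v)-T(u)|$. Let $p\ge 0$ be an integer and let $t_0,\dots,t_{p+1}$ be reals with $\sqrt n<t_0<t_1<\dots<t_p<t_{p+1}=n$. For $u,v\in V$ and $0\le j\le p+1$ put $$\hat A_j=\{w: u\to w,\ d(u,w)\le t_j,\ w<v\},\qquad \hat B_j=\{w: w\to v,\ d(w,v)\le t_j,\ w>u\}.$$ The algorithm maintains a topological order $T$ of a growing DAG. It starts with a DAG and a topological order of it. To insert an edge $(u,v)$, it calls $\textsc{Reorder}(v,u,0,0)$ if $v\le u$ (and leaves $T$ unchanged otherwise), and then adds the edge to the graph. The procedure $\textsc{Reorder}(u,v,f_1,f_2)$ is as follows. 1. If $v\le u$, exit. 2. If $t_i<d(u,v)\le t_{i+1}$ for some $i\in\{0,\dots,p\}$, compute $\hat A_i$ and $\hat B_i$. If $\hat A_i\ne\emptyset$ or $f_1=1$,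 set $A=\hat A_i$; otherwise also compute $\hat A_{i+1}$ and set $A=\hat A_{i+1}$. If $\hat B_i\ne\emptyset$ or $f_2=1$, set $B=\hat B_i$; otherwise also compute $\hat B_{i+1}$ and set $B=\hat B_{i+1}$. 3. Otherwise (that is, if $d(u,v)\le t_0$), compute $A=\hat A_0$ and $B=\hat B_0$. 4. If $A=B=\emptyset$, swap $u$ and $v$ in $T$ and exit. Otherwise, for each $u'\in\{u\}\cup A$ in decreasing order, and for each $v'\in B\cup\{v\}$ with $v'>u'$ in increasing order, call $\textsc{Reorder}(u',v',f_1',f_2')$, where $f_1'=1$ if and only if $u'=u$ and $A=\emptyset$, and $f_2'=1$ if and only if $v'=v$ and $B=\emptyset$. In these two loops "$v'>u'$" and the increasing and decreasing orders refer to the order $T$ at the start of the execution of $\textsc{Reorder}(u,v,f_1,f_2)$. **Theorem.** There is an absolute constant $C>0$ such that the following holds for all $n$, $p$, $t_0,\dots,t_{p+1}$ as above, every starting DAG with a topological order, and every finite sequence of edges whose insertion keeps the graph acyclic: the algorithm terminates, and for every $i\in\{0,\dots,p\}$, over the whole insertion sequence, the number of calls of $\textsc{Reorder}$ (recursive calls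 included) in which both $\hat A_i$ and $\hat A_{i+1}$ are computed is at most $$C\cdot\frac{n^2\sqrt{t_{i+1}}}{t_i},$$ and the number of calls of $\textsc{Reorder}$ in which both $\hat B_i$ and $\hat B_{i+1}$ are computed is at most the same bound. -/

import Mathlib

namespace OnlineTopSort

/-- The (topological) orders are the bijections of the vertex set onto the positions
`0, …, n - 1`; only comparisons and differences of positions are used. -/
abbrev Order (V : Type*) (n : ℕ) := V ≃ Fin n

/-- `d(u,v) = |T(v) - T(u)|`. -/
def posDist {V : Type*} {n : ℕ} (T : Order V n) (u v : V) : ℝ :=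
  |((T v : ℕ) : ℝ) - ((T u : ℕ) : ℝ)|

/-- `T` is a valid topological order of the digraph with edge relation `E`. -/
def IsTopOrder {V : Type*} {n : ℕ} (E : V → V → Prop) (T : Order V n) : Prop :=
  ∀ a b, E a b → T a < T b

/-- The digraph with edge relation `E` has no directed cycle (in particular no loop). -/
def Acyclic {V : Type*} (E : V → V → Prop) : Prop :=
  ∀ a, ¬ Relation.TransGen E a a

/-- The arguments `(u, v, f₁, f₂)` of a call of `Reorder`. -/
structure Call (V : Type*) where
  u : V
  v : V
  f₁ : Bool
  f₂ : Bool

/-- What is recorded about an executed call of `Reorder`: its arguments, the set of the `j` for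
which it computes `Â_j` and the set of the `j` for which it computes `B̂_j`. (This is about the
body of the call itself; each recursive call made by it has a record of its own.) -/
structure CallRecord (V : Type*) where
  call : Call V
  computedA : Finset ℕ
  computedB : Finset ℕ

/-- The result of running (part of) the algorithm: the order at the end, and the records of all
calls of `Reorder` executed meanwhile. -/
abbrev Outcome (V : Type*) (n : ℕ) := Order V n × List (CallRecord V)

section Algorithm

variable {V : Type*} [Fintype V] {n : ℕ}

open Classical in
/-- `Â_j = {w : u → w, d(u,w) ≤ t_j, w < v}`. -/
noncomputable def hatA (E : V → V → Prop) (t : ℕ → ℝ) (T : Order V n) (u v : V) (j : ℕ) :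
    Finset V :=
  Finset.univ.filter fun w => E u w ∧ posDist T u w ≤ t j ∧ T w < T v

open Classical in
/-- `B̂_j = {w : w → v, d(w,v) ≤ t_j, w > u}`. -/
noncomputable def hatB (E : V → V → Prop) (t : ℕ → ℝ) (T : Order V n) (u v : V) (j : ℕ) :
    Finset V :=
  Finset.univ.filter fun w => E w v ∧ posDist T w v ≤ t j ∧ T u < T w

open Classical in
/-- The `i ∈ {0, …, p}` with `t_i < d ≤ t_{i+1}`, if there is one. -/
noncomputable def level (p : ℕ) (t : ℕ → ℝ) (d : ℝ) : Option ℕ :=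
  (List.range (p + 1)).find? fun i => decide (t i < d ∧ d ≤ t (i + 1))

open Classical in
/-- The common selection rule for `A` (with `S = Â`, `f = f₁`) and for `B` (with `S = B̂`,
`f = f₂`): the chosen set, together with the set of the indices `j` for which `S j` is computed. -/
noncomputable def select (lev : Option ℕ) (f : Bool) (S : ℕ → Finset V) :
    Finset V × Finset ℕ :=
  match lev with
  | some i => if S i ≠ ∅ ∨ f = true then (S i, {i}) else (S (i + 1), {i, i + 1})
  | none => (S 0, {0})

open Classical in
/-- The elements of `S`, listed in increasing order with respect to `T`. -/
noncomputable def increasing (T : Order V n) (S : Finset V) : List V :=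
  ((List.finRange n).map T.symm).filter fun w => decide (w ∈ S)

open Classical in
/-- The recursive calls of the two nested loops, in the order in which they are made: `u'` runs
through `{u} ∪ A` in decreasing order, and for each `u'`, `v'` runs through the `v' > u'` in
`B ∪ {v}` in increasing order, where the order is the one at the start of the calling procedure. -/
noncomputable def recursiveCalls (T : Order V n) (u v : V) (A B : Finset V) : List (Call V) :=
  (increasing T (insert u A)).reverse.flatMap fun u' =>
    ((increasing T (insert v B)).filter fun v' => decide (T u' < T v')).map fun v' =>
      { u := u'
        v := v'
        f₁ := decide (u' = u ∧ A = ∅)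
        f₂ := decide (v' = v ∧ B = ∅) }

/-- Executes a list of calls one after the other by means of `exec`. -/
def runCalls (exec : Order V n → Call V → Option (Outcome V n)) :
    Order V n → List (Call V) → Option (Outcome V n)
  | T, [] => some (T, [])
  | T, c :: cs =>
    (exec T c).bind fun r => (runCalls exec r.1 cs).map fun s => (s.1, r.2 ++ s.2)

open Classical in
/-- The procedure `Reorder(u, v, f₁, f₂)`, on the graph `E`, with the current order `T`. The first
numeral bounds the depth of the recursion: the result is `none` if the execution needs a recursion
of greater depth, and otherwise it is the outcome of the execution, whatever the bound. -/
noncomputable def reorder (E : V → V → Prop) (p : ℕ) (t : ℕ → ℝ) :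
    ℕ → Order V n → Call V → Option (Outcome V n)
  | 0, _, _ => none
  | depth + 1, T, c =>
    if T c.v ≤ T c.u then
      some (T, [{ call := c, computedA := ∅, computedB := ∅ }])
    else
      let lev := level p t (posDist T c.u c.v)
      let a := select lev c.f₁ (hatA E t T c.u c.v)
      let b := select lev c.f₂ (hatB E t T c.u c.v)
      let record : CallRecord V := { call := c, computedA := a.2, computedB := b.2 }
      if a.1 = ∅ ∧ b.1 = ∅ then
        some ((Equiv.swap c.u c.v).trans T, [record])
      else
        (runCalls (reorder E p t depth) T (recursiveCalls T c.u c.v a.1 b.1)).map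
          fun r => (r.1, record :: r.2)

open Classical in
/-- The part of `Insert(u, v)` that updates the order: calls `Reorder(v, u, 0, 0)` if `v ≤ u`. -/
noncomputable def insertEdge (E : V → V → Prop) (p : ℕ) (t : ℕ → ℝ) (depth : ℕ) (T : Order V n)
    (u v : V) : Option (Outcome V n) :=
  if T v ≤ T u then reorder E p t depth T { u := v, v := u, f₁ := false, f₂ := false }
  else some (T, [])

/-- Inserts the edges of a list one after the other, starting from the graph `E` and the order
`T`. The outcome records the calls of `Reorder` over the whole insertion sequence. -/
noncomputable def insertEdges (p : ℕ) (t : ℕ → ℝ) (depth : ℕ) :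
    (V → V → Prop) → Order V n → List (V × V) → Option (Outcome V n)
  | _, T, [] => some (T, [])
  | E, T, e :: es =>
    (insertEdge E p t depth T e.1 e.2).bind fun r =>
      (insertEdges p t depth (fun a b => E a b ∨ (a = e.1 ∧ b = e.2)) r.1 es).map
        fun s => (s.1, r.2 ++ s.2)

end Algorithm

/-- The number of recorded calls that compute both `Â_i` and `Â_{i+1}`. -/
def countBothA {V : Type*} (i : ℕ) (log : List (CallRecord V)) : ℕ :=
  log.countP fun r => decide (i ∈ r.computedA ∧ i + 1 ∈ r.computedA)

/-- The number of recorded calls that compute both `B̂_i` and `B̂_{i+1}`. -/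
def countBothB {V : Type*} (i : ℕ) (log : List (CallRecord V)) : ℕ :=
  log.countP fun r => decide (i ∈ r.computedB ∧ i + 1 ∈ r.computedB)

end OnlineTopSort

namespace OnlineTopSort

/-!
While an edge `a → b` is inserted, only descendants of `b` and ancestors of `a` move, the former
upwards and the latter downwards. Hence a pair that has been swapped stays in its new order, every
swap makes progress, and the recursion ends.

Fix a topological order `F` of the final graph and put `τ = t_{i+1}`. The potential of an order `T`
is `Ω = τ · #{settled pairs at distance ≤ k in F} + (∑ x, T x · F x) / k`. A swap of `u < v` at
distance `d ≤ τ` raises it by at least `d`: if `u` and `v` are at distance at most `k` in `F`, they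
become a newly settled pair, worth `τ ≥ d`; otherwise the sum grows by `d (F u - F v) ≥ d k`. Since
each vertex has at most `k` such partners above it, `Ω ≤ τ n k + n³ / k`, which is `2 n² √τ` for
`k = n / √τ`.

A call that computes both `Â_i` and `Â_{i+1}` finds `Â_i` empty, so all successors of `u` below `v`
are farther than `t_i`, and all of them are in `Â_{i+1}`. Executing the call therefore moves `u` up
by more than `t_i`. The loops call `Reorder` for `u` itself only when none of its successors is left
below the other end; in each such clear call, the rise of `Ω` pays once for the move of `u` and once
for a double computation by the call itself. Hence `t_i` times the number of double computations is
at most twice the rise of `Ω`.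
-/

section Sides

/-- The two ends of a call: `lower` for `u`, `upper` for `v`. The algorithm and its analysis are
invariant under reversing all edges and the order, which exchanges the two sides; what follows is
therefore stated for an arbitrary side. -/
inductive Side
  | lower
  | upper

/-- The other side. -/
def Side.opp : Side → Side
  | lower => upper
  | upper => lower

@[simp]
lemma Side.opp_opp (s : Side) : s.opp.opp = s := by cases s <;> rfl

lemma Side.opp_ne (s : Side) : s.opp ≠ s := by cases s <;> simp [Side.opp]

lemma Side.eq_or_eq_opp (r s : Side) : r = s ∨ r = s.opp := by
  cases r <;> cases s <;> simp [Side.opp]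

lemma Side.forall_iff {P : Side → Prop} : (∀ s, P s) ↔ P lower ∧ P upper :=
  ⟨fun h => ⟨h lower, h upper⟩, fun h s => by cases s; exacts [h.1, h.2]⟩

variable {V : Type*} {n : ℕ}

/-- The position of `x` in `T`, with the sign that makes the end of a call on the side `s` the
smaller of the two ends. -/
def pos : Side → Order V n → V → ℝ
  | .lower, T, x => (T x : ℕ)
  | .upper, T, x => -(T x : ℕ)

/-- The edge relation as seen from the side `s`: edges are followed forwards from `u` and backwards
from `v`. -/
def Adj : Side → (V → V → Prop) → V → V → Prop
  | .lower, E, a, b => E a b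
  | .upper, E, a, b => E b a

/-- The vertex of a call at its end `s`. -/
def Call.tip (c : Call V) : Side → V
  | .lower => c.u
  | .upper => c.v

/-- The flag of a call that belongs to its end `s`. -/
def Call.flag (c : Call V) : Side → Bool
  | .lower => c.f₁
  | .upper => c.f₂

/-- The distance of the two ends of a call with `u < v`. -/
def Call.len (c : Call V) (T : Order V n) : ℝ := pos .lower T c.v - pos .lower T c.u

variable {E : V → V → Prop} {T T' : Order V n} {c : Call V} {s : Side} {w x y : V}

@[simp]
lemma pos_opp (s : Side) (T : Order V n) (x : V) : pos s.opp T x = -pos s T x := by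
  cases s <;> simp [pos, Side.opp]

lemma pos_inj : pos s T x = pos s T' y ↔ T x = T' y := by
  cases s <;> simp [pos, Fin.ext_iff]

lemma pos_lower_lt : pos .lower T x < pos .lower T' y ↔ T x < T' y := by
  simp [pos]

lemma pos_upper_lt : pos .upper T x < pos .upper T' y ↔ T' y < T x := by
  simp [pos]

lemma pos_tip_lt_pos_tip_opp :
    pos s T (c.tip s) < pos s T (c.tip s.opp) ↔ T c.u < T c.v := by
  cases s <;> simp [pos, Call.tip, Side.opp]

lemma pos_tip_opp_lt_pos_tip :
    pos s T (c.tip s.opp) < pos s T (c.tip s) ↔ T c.v < T c.u := by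
  cases s <;> simp [pos, Call.tip, Side.opp]

lemma pos_tip_opp_le_pos_tip :
    pos s T (c.tip s.opp) ≤ pos s T (c.tip s) ↔ T c.v ≤ T c.u := by
  rw [← not_lt, pos_tip_lt_pos_tip_opp, not_lt]

lemma Call.len_eq (c : Call V) (T : Order V n) (s : Side) :
    c.len T = pos s T (c.tip s.opp) - pos s T (c.tip s) := by
  cases s
  · rfl
  · simp only [len, pos, tip, Side.opp]
    ring

lemma posDist_eq_of_pos_le (h : pos s T x ≤ pos s T y) :
    posDist T x y = pos s T y - pos s T x := by
  cases s
  · exact abs_of_nonneg (sub_nonneg.2 h)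
  · rw [posDist, abs_sub_comm, abs_of_nonneg] <;> simp only [pos] at * <;> linarith

lemma posDist_comm (T : Order V n) (x y : V) : posDist T x y = posDist T y x :=
  abs_sub_comm _ _

lemma Call.posDist_eq_len (hc : T c.u < T c.v) : posDist T c.u c.v = c.len T :=
  posDist_eq_of_pos_le (s := .lower) (pos_lower_lt.2 hc).le

lemma Call.len_pos (hc : T c.u < T c.v) : 0 < c.len T :=
  sub_pos.2 (pos_lower_lt.2 hc)

lemma Call.len_le (c : Call V) (T : Order V n) : c.len T ≤ n := by
  have hv : ((T c.v : ℕ) : ℝ) ≤ n := by exact_mod_cast (T c.v).2.le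
  exact (sub_le_self _ (Nat.cast_nonneg _)).trans hv

lemma IsTopOrder.pos_lt (hT : IsTopOrder E T) (h : Adj s E x y) : pos s T x < pos s T y := by
  cases s
  · exact pos_lower_lt.2 (hT _ _ h)
  · exact pos_upper_lt.2 (hT _ _ h)

lemma IsTopOrder.lt_of_transGen (hT : IsTopOrder E T) (h : Relation.TransGen E x y) :
    T x < T y := by
  induction h with
  | single h => exact hT _ _ h
  | tail _ h ih => exact ih.trans (hT _ _ h)

/-- The neighbour `w` of the end `s` of a call lies before the other end, so that the two ends
cannot simply be swapped. -/
def Blocks (E : V → V → Prop) (s : Side) (T : Order V n) (c : Call V) (w : V) : Prop :=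
  Adj s E (c.tip s) w ∧ pos s T w < pos s T (c.tip s.opp)

/-- Nothing on the side `s` prevents the ends of a call from being swapped. -/
def Clear (E : V → V → Prop) (s : Side) (T : Order V n) (c : Call V) : Prop :=
  ∀ w, ¬ Blocks E s T c w

end Sides

section Swaps

variable {V : Type*} {n : ℕ} {E : V → V → Prop} {K : Side → Set V} {T T' : Order V n}
  {c : Call V} {s : Side} {x y : V}

/-- `K lower` is closed under successors, `K upper` under predecessors, and they are disjoint. While
an edge `a → b` is inserted, these are the descendants of `b` and the ancestors of `a`. -/
structure Cones (E : V → V → Prop) (K : Side → Set V) : Prop where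
  closed : ∀ {s x y}, x ∈ K s → Adj s E x y → y ∈ K s
  disjoint : Disjoint (K .lower) (K .upper)

lemma Cones.ne (hK : Cones E K) (hx : x ∈ K s) (hy : y ∈ K s.opp) : x ≠ y := by
  cases s
  · exact hK.disjoint.ne_of_mem hx hy
  · exact (hK.disjoint.ne_of_mem hy hx).symm

open Classical in
/-- `T'` arises from `T` by a swap of the ends of the call `c` as it is made by the algorithm. -/
structure LegalSwap (E : V → V → Prop) (K : Side → Set V) (T : Order V n) (c : Call V)
    (T' : Order V n) : Prop where
  cone : ∀ s, c.tip s ∈ K s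
  lt : T c.u < T c.v
  clear : ∀ s, Clear E s T c
  eq : T' = (Equiv.swap c.u c.v).trans T

namespace LegalSwap

lemma apply_tip (h : LegalSwap E K T c T') (s : Side) : T' (c.tip s) = T (c.tip s.opp) := by
  rw [h.eq]
  cases s <;> simp [Call.tip, Side.opp]

lemma apply_of_ne (h : LegalSwap E K T c T') (hu : x ≠ c.u) (hv : x ≠ c.v) : T' x = T x := by
  classical
  rw [h.eq, Equiv.trans_apply, Equiv.swap_apply_of_ne_of_ne hu hv]

lemma pos_le_of_ne_tip (h : LegalSwap E K T c T') (hx : x ≠ c.tip s) :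
    pos s T' x ≤ pos s T x := by
  by_cases hx' : x = c.tip s.opp
  · rw [hx', pos_inj.2 (h.apply_tip s.opp), Side.opp_opp]
    exact (pos_tip_lt_pos_tip_opp.2 h.lt).le
  · refine (pos_inj.2 ?_).le
    cases s
    exacts [h.apply_of_ne hx hx', h.apply_of_ne hx' hx]

lemma le_pos_of_ne_tip_opp (h : LegalSwap E K T c T') (hx : x ≠ c.tip s.opp) :
    pos s T x ≤ pos s T' x := by
  simpa using h.pos_le_of_ne_tip hx

lemma pos_le (hK : Cones E K) (h : LegalSwap E K T c T') (hx : x ∈ K s) :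
    pos s T x ≤ pos s T' x :=
  h.le_pos_of_ne_tip_opp (hK.ne hx (h.cone s.opp))

lemma pos_tip_lt (h : LegalSwap E K T c T') (s : Side) :
    pos s T (c.tip s) < pos s T' (c.tip s) := by
  rw [pos_inj.2 (h.apply_tip s)]
  exact pos_tip_lt_pos_tip_opp.2 h.lt

lemma pos_lt_of_adj_tip (hK : Cones E K) (h : LegalSwap E K T c T') (hy : Adj s E (c.tip s) y) :
    pos s T' (c.tip s) < pos s T' y := by
  have hne : y ≠ c.tip s.opp := hK.ne (hK.closed (h.cone s) hy) (h.cone s.opp)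
  have hle : pos s T (c.tip s.opp) ≤ pos s T y := not_lt.1 fun hlt => h.clear s y ⟨hy, hlt⟩
  calc pos s T' (c.tip s) = pos s T (c.tip s.opp) := pos_inj.2 (h.apply_tip s)
    _ < pos s T y := hle.lt_of_ne fun he => hne (T.injective (pos_inj.1 he)).symm
    _ ≤ pos s T' y := h.le_pos_of_ne_tip_opp hne

lemma isTopOrder (hK : Cones E K) (h : LegalSwap E K T c T') (hT : IsTopOrder E T) :
    IsTopOrder E T' := by
  intro a b hab
  by_cases ha : a = c.tip .lower
  · subst ha
    exact pos_lower_lt.1 (h.pos_lt_of_adj_tip hK hab)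
  by_cases hb : b = c.tip .upper
  · subst hb
    exact pos_upper_lt.1 (h.pos_lt_of_adj_tip (s := .upper) hK hab)
  refine pos_lower_lt.1 ?_
  calc pos .lower T' a ≤ pos .lower T a := h.pos_le_of_ne_tip ha
    _ < pos .lower T b := pos_lower_lt.2 (hT a b hab)
    _ ≤ pos .lower T' b := h.le_pos_of_ne_tip_opp hb

end LegalSwap

/-- `T₁` arises from `T` by a single legal swap. -/
def SwapStep (E : V → V → Prop) (K : Side → Set V) (T T₁ : Order V n) : Prop :=
  ∃ c, LegalSwap E K T c T₁

/-- `T'` arises from `T` by a sequence of legal swaps. -/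
abbrev Reach (E : V → V → Prop) (K : Side → Set V) : Order V n → Order V n → Prop :=
  Relation.ReflTransGen (SwapStep E K)

namespace Reach

lemma isTopOrder (hK : Cones E K) (h : Reach E K T T') (hT : IsTopOrder E T) :
    IsTopOrder E T' := by
  induction h with
  | refl => exact hT
  | tail _ hstep ih => exact hstep.choose_spec.isTopOrder hK ih

lemma pos_le (hK : Cones E K) (h : Reach E K T T') (hx : x ∈ K s) : pos s T x ≤ pos s T' x := by
  induction h with
  | refl => exact le_rfl
  | tail _ hstep ih => exact ih.trans (hstep.choose_spec.pos_le hK hx)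

lemma pos_ge (hK : Cones E K) (h : Reach E K T T') (hx : x ∈ K s.opp) :
    pos s T' x ≤ pos s T x := by
  simpa using h.pos_le hK hx

lemma transGen_of_ne (h : Reach E K T T') (hne : T' ≠ T) :
    Relation.TransGen (SwapStep E K) T T' :=
  (Relation.reflTransGen_iff_eq_or_transGen.1 h).resolve_left hne

end Reach

lemma not_transGen_swapStep_self (hK : Cones E K) (T : Order V n) :
    ¬ Relation.TransGen (SwapStep E K) T T := by
  intro h
  obtain ⟨T₁, ⟨c, hc⟩, hback⟩ := Relation.TransGen.head'_iff.1 h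
  exact (hc.pos_tip_lt .lower).not_ge (Reach.pos_le hK hback (hc.cone .lower))

lemma wellFounded_transGen_swapStep (hK : Cones E K) :
    WellFounded fun T' T : Order V n => Relation.TransGen (SwapStep E K) T T' :=
  have : IsTrans (Order V n) fun T' T => Relation.TransGen (SwapStep E K) T T' :=
    ⟨fun _ _ _ h₁ h₂ => h₂.trans h₁⟩
  have : Std.Irrefl fun T' T : Order V n => Relation.TransGen (SwapStep E K) T T' :=
    ⟨not_transGen_swapStep_self hK⟩
  Finite.wellFounded_of_trans_of_irrefl _

/-- `T'` differs from `T` only between the two ends of the call `c`. -/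
def FixesOutside (T : Order V n) (c : Call V) (T' : Order V n) : Prop :=
  ∀ s x, pos s T x < pos s T (c.tip s) → T' x = T x

namespace FixesOutside

lemma refl (T : Order V n) (c : Call V) : FixesOutside T c T := fun _ _ _ => rfl

lemma le_pos (h : FixesOutside T c T') (hx : pos s T (c.tip s) ≤ pos s T x) :
    pos s T (c.tip s) ≤ pos s T' x := by
  by_contra! hlt
  obtain ⟨y, hy⟩ := T.surjective (T' x)
  have hfix : T' y = T y := h s y (by rwa [pos_inj.2 hy])
  obtain rfl : y = x := T'.injective (hfix.trans hy)
  rw [← pos_inj.2 hy] at hlt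
  exact hlt.not_ge hx

lemma pos_le (h : FixesOutside T c T') (hx : pos s T x ≤ pos s T (c.tip s.opp)) :
    pos s T' x ≤ pos s T (c.tip s.opp) := by
  have := h.le_pos (s := s.opp) (x := x) (by simpa using hx)
  simpa using this

end FixesOutside

/-- What every execution of the call `c` achieves that leads from `T` to `T'`. -/
structure Resolves (E : V → V → Prop) (K : Side → Set V) (T : Order V n) (c : Call V)
    (T' : Order V n) : Prop where
  reach : Reach E K T T'
  fixes : FixesOutside T c T'
  sep : T' c.v < T' c.u
  cross : ∀ s, Clear E s T c → T c.u < T c.v → T' (c.tip s) = T (c.tip s.opp)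

/-- What holds whenever the algorithm makes a call. -/
structure Admissible (E : V → V → Prop) (K : Side → Set V) (T : Order V n) (c : Call V) :
    Prop where
  top : IsTopOrder E T
  cone : ∀ s, c.tip s ∈ K s
  clear : ∀ s, c.flag s = true → Clear E s T c

lemma Admissible.resolves_of_le (hK : Cones E K) (h : Admissible E K T c) (hc : T c.v ≤ T c.u) :
    Resolves E K T c T where
  reach := .refl
  fixes := .refl T c
  sep := hc.lt_of_ne fun he => hK.ne (h.cone .lower) (h.cone .upper) (T.injective he).symm
  cross _ _ hlt := absurd hlt hc.not_gt

lemma LegalSwap.fixesOutside (h : LegalSwap E K T c T') : FixesOutside T c T' := by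
  intro s x hx
  have hs : x ≠ c.tip s := by
    rintro rfl
    exact lt_irrefl _ hx
  have hs' : x ≠ c.tip s.opp := by
    rintro rfl
    exact hx.not_gt (pos_tip_lt_pos_tip_opp.2 h.lt)
  cases s
  exacts [h.apply_of_ne hs hs', h.apply_of_ne hs' hs]

lemma LegalSwap.resolves (h : LegalSwap E K T c T') : Resolves E K T c T' where
  reach := .single ⟨c, h⟩
  fixes := h.fixesOutside
  sep := pos_tip_opp_lt_pos_tip (s := .lower).1 <| by
    have hs := pos_tip_lt_pos_tip_opp (s := .lower).2 h.lt
    rwa [pos_inj.2 (h.apply_tip .lower), pos_inj.2 (h.apply_tip _), Side.opp_opp]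
  cross s _ _ := h.apply_tip s

end Swaps

section Steps

variable {V : Type*} {n : ℕ}
  {P Q : Order V n → Call V → Order V n → List (CallRecord V) → Prop}
  {cs : List (Call V)} {T T' : Order V n} {L : List (CallRecord V)}

/-- The calls of a list are executed one after the other, the execution of each one satisfying
`P`. -/
def Steps (P : Order V n → Call V → Order V n → List (CallRecord V) → Prop) :
    Order V n → List (Call V) → Order V n → List (CallRecord V) → Prop
  | T, [], T', L => T' = T ∧ L = []
  | T, c :: cs, T', L => ∃ T₁ L₁ L₂, P T c T₁ L₁ ∧ Steps P T₁ cs T' L₂ ∧ L = L₁ ++ L₂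

lemma steps_of_runCalls {exec : Order V n → Call V → Option (Outcome V n)}
    (h : runCalls exec T cs = some (T', L)) :
    Steps (fun T c T' L => exec T c = some (T', L)) T cs T' L := by
  induction cs generalizing T L with
  | nil =>
    simp only [runCalls, Option.some.injEq, Prod.mk.injEq] at h
    exact ⟨h.1.symm, h.2.symm⟩
  | cons c cs ih =>
    simp only [runCalls, Option.bind_eq_some_iff, Option.map_eq_some_iff, Prod.mk.injEq] at h
    obtain ⟨⟨T₁, L₁⟩, hc, ⟨T₂, L₂⟩, hcs, rfl, rfl⟩ := h
    exact ⟨T₁, L₁, L₂, hc, ih hcs, rfl⟩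

lemma Steps.induction_on_done {I : List (Call V) → Order V n → Prop} (h : Steps P T cs T' L)
    (hT : I [] T)
    (hstep : ∀ l c l' T₁ T₂ L₁, cs = l ++ c :: l' → I l T₁ → P T₁ c T₂ L₁ →
      Q T₁ c T₂ L₁ ∧ I (l ++ [c]) T₂) :
    Steps Q T cs T' L ∧ I cs T' := by
  induction cs generalizing T L I with
  | nil => exact ⟨h, h.1 ▸ hT⟩
  | cons c cs ih =>
    obtain ⟨T₁, L₁, L₂, hc, hcs, rfl⟩ := h
    have hfirst := hstep [] c cs T T₁ L₁ rfl hT hc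
    have hrest := ih (I := fun l => I (c :: l)) hcs hfirst.2 fun l d l' T₂ T₃ L₃ hl =>
      hstep (c :: l) d l' T₂ T₃ L₃ (by rw [hl, List.cons_append])
    exact ⟨⟨T₁, L₁, L₂, hfirst.1, hrest.1, rfl⟩, hrest.2⟩

lemma Steps.mono (h : Steps P T cs T' L) (hPQ : ∀ T c T' L, P T c T' L → Q T c T' L) :
    Steps Q T cs T' L :=
  (h.induction_on_done (I := fun _ _ => True) trivial fun _ _ _ _ _ _ _ _ hP =>
    ⟨hPQ _ _ _ _ hP, trivial⟩).1

lemma Steps.invariant {I : Order V n → Prop} (h : Steps P T cs T' L) (hT : I T)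
    (hI : ∀ T₁ c T₂ L₁, P T₁ c T₂ L₁ → I T₁ → I T₂) : I T' :=
  (h.induction_on_done (Q := P) (I := fun _ => I) hT fun _ _ _ _ _ _ _ hI₁ hP =>
    ⟨hP, hI _ _ _ _ hP hI₁⟩).2

end Steps

section Children

variable {V : Type*} {n : ℕ} {T : Order V n} {c c' d : Call V} {S : Side → Finset V} {s : Side}
  {w : V}

/-- The recursive calls of the call `c` if it chooses `A = S lower` and `B = S upper`. -/
noncomputable def Call.children (T : Order V n) (c : Call V) (S : Side → Finset V) :
    List (Call V) :=
  recursiveCalls T c.u c.v (S .lower) (S .upper)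

lemma mem_increasing (T : Order V n) (A : Finset V) (x : V) : x ∈ increasing T A ↔ x ∈ A := by
  classical
  simp only [increasing, List.mem_filter, List.mem_map, List.mem_finRange, true_and,
    decide_eq_true_eq, and_iff_right_iff_imp]
  exact fun _ => ⟨T x, T.symm_apply_apply x⟩

lemma pairwise_increasing (T : Order V n) (A : Finset V) :
    (increasing T A).Pairwise fun a b => T a < T b := by
  classical
  refine List.Pairwise.filter _ (List.pairwise_map.2 ?_)
  simpa only [Equiv.apply_symm_apply] using List.pairwise_lt_finRange n

lemma mem_recursiveCalls {u v : V} {A B : Finset V} :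
    d ∈ recursiveCalls T u v A B ↔ (d.u = u ∨ d.u ∈ A) ∧ (d.v = v ∨ d.v ∈ B) ∧ T d.u < T d.v ∧
      (d.f₁ = true ↔ d.u = u ∧ A = ∅) ∧ (d.f₂ = true ↔ d.v = v ∧ B = ∅) := by
  classical
  simp only [recursiveCalls, List.mem_flatMap, List.mem_reverse, mem_increasing, List.mem_map,
    List.mem_filter, decide_eq_true_eq, Finset.mem_insert]
  constructor
  · rintro ⟨a, ha, b, ⟨hb, hab⟩, rfl⟩
    simp [ha, hb, hab]
  · rintro ⟨hu, hv, hlt, hf₁, hf₂⟩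
    refine ⟨d.u, hu, d.v, ⟨hv, hlt⟩, ?_⟩
    rw [← Bool.decide_congr hf₁, ← Bool.decide_congr hf₂, Bool.decide_eq_true,
      Bool.decide_eq_true]

lemma pairwise_recursiveCalls (T : Order V n) (u v : V) (A B : Finset V) :
    (recursiveCalls T u v A B).Pairwise fun a b => T b.u < T a.u ∨ T a.v < T b.v := by
  classical
  rw [recursiveCalls, List.pairwise_flatMap, List.pairwise_reverse]
  constructor
  · intro a _
    exact List.pairwise_map.2 (((pairwise_increasing T _).filter _).imp Or.inr)
  · refine (pairwise_increasing T _).imp fun hlt a ha b hb => Or.inl ?_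
    obtain ⟨-, -, rfl⟩ := List.mem_map.1 ha
    obtain ⟨-, -, rfl⟩ := List.mem_map.1 hb
    exact hlt

lemma mem_children :
    d ∈ c.children T S ↔ (∀ s, d.tip s = c.tip s ∨ d.tip s ∈ S s) ∧ T d.u < T d.v ∧
      ∀ s, (d.flag s = true ↔ d.tip s = c.tip s ∧ S s = ∅) := by
  simp only [Call.children, mem_recursiveCalls, Side.forall_iff, Call.tip, Call.flag]
  tauto

lemma pairwise_children (T : Order V n) (c : Call V) (S : Side → Finset V) :
    (c.children T S).Pairwise fun a b => ∃ s, pos s T (b.tip s) < pos s T (a.tip s) := by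
  refine (pairwise_recursiveCalls T _ _ _ _).imp fun h => ?_
  rcases h with h | h
  exacts [⟨.lower, pos_lower_lt.2 h⟩, ⟨.upper, pos_upper_lt.2 h⟩]

lemma exists_mem_children {x : Side → V} (hx : ∀ s, x s = c.tip s ∨ x s ∈ S s)
    (hlt : T (x .lower) < T (x .upper)) : ∃ d ∈ c.children T S, ∀ s, d.tip s = x s := by
  classical
  refine ⟨⟨x .lower, x .upper, decide (x .lower = c.tip .lower ∧ S .lower = ∅),
    decide (x .upper = c.tip .upper ∧ S .upper = ∅)⟩, ?_, Side.forall_iff.2 ⟨rfl, rfl⟩⟩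
  simp only [mem_children, Side.forall_iff, Call.tip, Call.flag]
  exact ⟨⟨hx .lower, hx .upper⟩, hlt, decide_eq_true_iff, decide_eq_true_iff⟩

lemma exists_mem_done {done rest : List (Call V)} (hcs : c.children T S = done ++ c' :: rest)
    (htip : c'.tip s = c.tip s) (hw : w ∈ S s) (hlo : pos s T (c.tip s) < pos s T w)
    (hup : pos s T w < pos s T (c'.tip s.opp)) :
    ∃ d ∈ done, d.tip s = w ∧ d.tip s.opp = c'.tip s.opp := by
  classical
  have hc' : c' ∈ c.children T S := by simp [hcs]
  have hlt : T (Function.update c'.tip s w .lower) < T (Function.update c'.tip s w .upper) := by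
    cases s
    · exact pos_lower_lt.1 (by simpa [Side.opp] using hup)
    · exact pos_upper_lt.1 (by simpa [Side.opp] using hup)
  obtain ⟨d, hd, htips⟩ := exists_mem_children (x := Function.update c'.tip s w) (S := S) (c := c)
    (fun r => by
      by_cases hr : r = s
      · subst hr
        exact .inr (by simpa using hw)
      · simpa [hr] using (mem_children.1 hc').1 r) hlt
  have hds : d.tip s = w := by simpa using htips s
  have hds' : d.tip s.opp = c'.tip s.opp := by simpa [s.opp_ne] using htips s.opp
  have hpw := pairwise_children T c S
  rw [hcs, List.pairwise_append, List.pairwise_cons] at hpw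
  rw [hcs, List.mem_append, List.mem_cons] at hd
  rcases hd with hd | rfl | hd
  · exact ⟨d, hd, hds, hds'⟩
  · exact absurd hlo (by rw [← htip, hds]; exact lt_irrefl _)
  · obtain ⟨r, hr⟩ := hpw.2.1.1 d hd
    rcases r.eq_or_eq_opp s with rfl | rfl
    · rw [hds, htip] at hr
      exact absurd hr hlo.not_gt
    · rw [hds'] at hr
      exact absurd hr (lt_irrefl _)

end Children

section Selection

variable {V : Type*} {n : ℕ} {E : V → V → Prop} {t : ℕ → ℝ} {p i j : ℕ} {d : ℝ}
  {T : Order V n} {c : Call V} {s : Side} {w : V}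

lemma level_eq_some (h : level p t d = some i) : t i < d ∧ d ≤ t (i + 1) := by
  classical
  simpa using List.find?_some h

lemma level_eq_none (hd : d ≤ t (p + 1)) (h : level p t d = none) : d ≤ t 0 := by
  classical
  have hstep : ∀ i < p + 1, t i < d → t (i + 1) < d := by simpa [level] using h
  by_contra! h₀
  have hlt : ∀ i ≤ p + 1, t i < d := by
    intro i
    induction i with
    | zero => exact fun _ => h₀
    | succ i ih => exact fun hi => hstep i (by omega) (ih (by omega))
  exact hd.not_gt (hlt _ le_rfl)

lemma exists_select_fst_eq (lev : Option ℕ) (f : Bool) (A : ℕ → Finset V) :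
    ∃ j, (select lev f A).1 = A j := by
  unfold select
  split
  · split
    exacts [⟨_, rfl⟩, ⟨_, rfl⟩]
  · exact ⟨_, rfl⟩

lemma select_fst_eq_empty {lev : Option ℕ} {f : Bool} {A : ℕ → Finset V}
    (h : (select lev f A).1 = ∅) :
    f = true ∨ (lev = none ∧ A 0 = ∅) ∨ ∃ i, lev = some i ∧ A (i + 1) = ∅ := by
  unfold select at h
  split at h
  · split at h
    · next hA => exact .inl (hA.resolve_left (not_not_intro h))
    · exact .inr (.inr ⟨_, rfl, h⟩)
  · exact .inr (.inl ⟨rfl, h⟩)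

lemma select_of_mem_snd {lev : Option ℕ} {f : Bool} {A : ℕ → Finset V}
    (hi : i ∈ (select lev f A).2) (hi' : i + 1 ∈ (select lev f A).2) :
    lev = some i ∧ A i = ∅ ∧ f = false ∧ (select lev f A).1 = A (i + 1) := by
  unfold select at hi hi' ⊢
  split at hi
  · next j =>
    by_cases hA : A j ≠ ∅ ∨ f = true
    · simp only [if_pos hA, Finset.mem_singleton] at hi hi'
      omega
    · simp only [if_neg hA, Finset.mem_insert, Finset.mem_singleton] at hi hi' ⊢
      obtain rfl : i = j := by omega
      push Not at hA
      simpa using hA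
  · simp only [Finset.mem_singleton] at hi hi'
    omega

variable [Fintype V]

/-- The set `Â_j` on the lower, and `B̂_j` on the upper side of a call. -/
noncomputable def hat (E : V → V → Prop) (t : ℕ → ℝ) (T : Order V n) (c : Call V) :
    Side → ℕ → Finset V
  | .lower => hatA E t T c.u c.v
  | .upper => hatB E t T c.u c.v

lemma mem_hat (hT : IsTopOrder E T) :
    w ∈ hat E t T c s j ↔ Blocks E s T c w ∧ pos s T w - pos s T (c.tip s) ≤ t j := by
  have hdist (h : Adj s E (c.tip s) w) :
      posDist T (c.tip s) w = pos s T w - pos s T (c.tip s) :=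
    posDist_eq_of_pos_le (hT.pos_lt h).le
  have hmem : w ∈ hat E t T c s j ↔
      Adj s E (c.tip s) w ∧ posDist T (c.tip s) w ≤ t j ∧ pos s T w < pos s T (c.tip s.opp) := by
    cases s
    · simp [hat, hatA, Adj, Call.tip, Side.opp, pos]
    · simp [hat, hatB, Adj, Call.tip, Side.opp, pos, posDist_comm T w]
  rw [hmem, Blocks]
  constructor
  · rintro ⟨hadj, hle, hlt⟩
    exact ⟨⟨hadj, hlt⟩, hdist hadj ▸ hle⟩
  · rintro ⟨⟨hadj, hlt⟩, hle⟩
    exact ⟨hadj, (hdist hadj).symm ▸ hle, hlt⟩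

lemma Blocks.mem_hat (h : Blocks E s T c w) (hT : IsTopOrder E T) (hj : c.len T ≤ t j) :
    w ∈ hat E t T c s j := by
  refine (OnlineTopSort.mem_hat hT).2 ⟨h, le_trans ?_ hj⟩
  rw [c.len_eq T s]
  linarith [h.2]

/-- The set that a call chooses as `A` (on the lower side) or as `B` (on the upper side). -/
noncomputable def chosen (E : V → V → Prop) (p : ℕ) (t : ℕ → ℝ) (T : Order V n) (c : Call V)
    (s : Side) : Finset V :=
  (select (level p t (posDist T c.u c.v)) (c.flag s) (hat E t T c s)).1

/-- The indices `j` for which a call computes `Â_j` (on the lower side) or `B̂_j` (on the upper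
side). -/
noncomputable def computed (E : V → V → Prop) (p : ℕ) (t : ℕ → ℝ) (T : Order V n) (c : Call V)
    (s : Side) : Finset ℕ :=
  (select (level p t (posDist T c.u c.v)) (c.flag s) (hat E t T c s)).2

lemma blocks_of_mem_chosen (hT : IsTopOrder E T) (hw : w ∈ chosen E p t T c s) :
    Blocks E s T c w := by
  obtain ⟨j, hj⟩ := exists_select_fst_eq (level p t (posDist T c.u c.v)) (c.flag s)
    (hat E t T c s)
  rw [chosen, hj] at hw
  exact ((mem_hat hT).1 hw).1

lemma clear_of_chosen_eq_empty (hT : IsTopOrder E T) (hp : (n : ℝ) ≤ t (p + 1))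
    (hc : T c.u < T c.v) (hflag : c.flag s = true → Clear E s T c)
    (h : chosen E p t T c s = ∅) : Clear E s T c := by
  have hclear {j : ℕ} (hj : c.len T ≤ t j) (hA : hat E t T c s j = ∅) : Clear E s T c :=
    fun w hw => Finset.notMem_empty w (hA ▸ hw.mem_hat hT hj)
  rcases select_fst_eq_empty h with hf | ⟨hlev, hA⟩ | ⟨i, hlev, hA⟩
  · exact hflag hf
  · rw [Call.posDist_eq_len hc] at hlev
    exact hclear (level_eq_none ((c.len_le T).trans hp) hlev) hA
  · rw [Call.posDist_eq_len hc] at hlev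
    exact hclear (level_eq_some hlev).2 hA

/-- The situation of a call that computes both `Â_i` and `Â_{i+1}` (or `B̂_i` and `B̂_{i+1}`) and
chooses `A`: since the first of the two sets is empty, all blocking vertices are far away. -/
structure DoubleScan (E : V → V → Prop) (t : ℕ → ℝ) (T : Order V n) (c : Call V) (s : Side)
    (i : ℕ) (A : Finset V) : Prop where
  flag : c.flag s = false
  lt_len : t i < c.len T
  len_le : c.len T ≤ t (i + 1)
  full : ∀ w, Blocks E s T c w → w ∈ A
  far : ∀ w ∈ A, t i < pos s T w - pos s T (c.tip s)

lemma doubleScan_of_mem_computed (hT : IsTopOrder E T) (hc : T c.u < T c.v)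
    (hi : i ∈ computed E p t T c s) (hi' : i + 1 ∈ computed E p t T c s) :
    DoubleScan E t T c s i (chosen E p t T c s) := by
  obtain ⟨hlev, hempty, hflag, hchosen⟩ := select_of_mem_snd hi hi'
  rw [Call.posDist_eq_len hc] at hlev
  obtain ⟨hlt, hle⟩ := level_eq_some hlev
  refine ⟨hflag, hlt, hle, fun w hw => ?_, fun w hw => ?_⟩ <;> rw [chosen, hchosen] at *
  · exact hw.mem_hat hT hle
  · have hblocks := ((mem_hat hT).1 hw).1
    by_contra! hnear
    exact Finset.notMem_empty w (hempty ▸ (mem_hat hT).2 ⟨hblocks, hnear⟩)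

/-- What is recorded about the call `c` if it is not left at once. -/
noncomputable def record (E : V → V → Prop) (p : ℕ) (t : ℕ → ℝ) (T : Order V n) (c : Call V) :
    CallRecord V :=
  ⟨c, computed E p t T c .lower, computed E p t T c .upper⟩

lemma reorder_of_le (hc : T c.v ≤ T c.u) (depth : ℕ) :
    reorder E p t (depth + 1) T c = some (T, [⟨c, ∅, ∅⟩]) := by
  rw [reorder, if_pos hc]

open Classical in
lemma reorder_of_chosen_eq_empty (hc : T c.u < T c.v) (h : ∀ s, chosen E p t T c s = ∅)
    (depth : ℕ) :
    reorder E p t (depth + 1) T c =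
      some ((Equiv.swap c.u c.v).trans T, [record E p t T c]) := by
  rw [reorder, if_neg hc.not_ge]
  exact if_pos ⟨h .lower, h .upper⟩

lemma reorder_of_chosen_ne_empty (hc : T c.u < T c.v) (hs : chosen E p t T c s ≠ ∅)
    (depth : ℕ) :
    reorder E p t (depth + 1) T c =
      (runCalls (reorder E p t depth) T (c.children T (chosen E p t T c))).map fun r =>
        (r.1, record E p t T c :: r.2) := by
  rw [reorder, if_neg hc.not_ge]
  refine if_neg fun h => hs ?_
  cases s
  exacts [h.1, h.2]

end Selection

section Branching

variable {V : Type*} {n : ℕ} {E : V → V → Prop} {K : Side → Set V} {T T₁ T₂ T' : Order V n}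
  {c c' : Call V} {S : Side → Finset V} {s : Side} {w : V} {done : List (Call V)}
  {L : List (CallRecord V)} {m : ℝ}
  {R : Order V n → Call V → Order V n → List (CallRecord V) → Prop}

/-- The situation in which the call `c` chooses the sets `S` and makes recursive calls. -/
structure Branching (E : V → V → Prop) (K : Side → Set V) (T : Order V n) (c : Call V)
    (S : Side → Finset V) : Prop where
  cones : Cones E K
  adm : Admissible E K T c
  lt : T c.u < T c.v
  blocks : ∀ s, ∀ w ∈ S s, Blocks E s T c w
  clear : ∀ s, S s = ∅ → Clear E s T c

/-- The loop invariant of a call `c` on the order `T`: what holds of the current order `T₁` after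
the recursive calls in the list `done`. -/
structure LoopState (E : V → V → Prop) (K : Side → Set V) (T : Order V n) (c : Call V)
    (done : List (Call V)) (T₁ : Order V n) : Prop where
  reach : Reach E K T T₁
  fixes : FixesOutside T c T₁
  resolved : ∀ d ∈ done, T₁ d.v < T₁ d.u

lemma LoopState.nil (E : V → V → Prop) (K : Side → Set V) (T : Order V n) (c : Call V) :
    LoopState E K T c [] T :=
  ⟨.refl, .refl T c, fun _ hd => absurd hd List.not_mem_nil⟩

lemma LoopState.transGen (hT₁ : LoopState E K T c done T₁) {d : Call V} (hd : d ∈ done)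
    (hlt : T d.u < T d.v) : Relation.TransGen (SwapStep E K) T T₁ :=
  hT₁.reach.transGen_of_ne fun he => (he ▸ hT₁.resolved d hd).not_gt hlt

/-- The execution of the recursive call `c'` leads from `T₁` to `T₂`, within the loop of the call
`c` on the order `T`. -/
def LoopStep (E : V → V → Prop) (K : Side → Set V) (T : Order V n) (c : Call V)
    (S : Side → Finset V) (T₁ : Order V n) (c' : Call V) (T₂ : Order V n) : Prop :=
  Resolves E K T₁ c' T₂ ∧
    ∃ done rest, c.children T S = done ++ c' :: rest ∧ LoopState E K T c done T₁

namespace Branching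

lemma cone_of_mem (h : Branching E K T c S) (hc' : c' ∈ c.children T S) (s : Side) :
    c'.tip s ∈ K s := by
  rcases (mem_children.1 hc').1 s with htip | hw
  · exact htip ▸ h.adm.cone s
  · exact h.cones.closed (h.adm.cone s) (h.blocks s _ hw).1

lemma pos_tip_le (h : Branching E K T c S) (hT₁ : LoopState E K T c done T₁)
    (hc' : c' ∈ c.children T S) (s : Side) : pos s T (c.tip s) ≤ pos s T₁ (c'.tip s) := by
  refine hT₁.fixes.le_pos ?_
  rcases (mem_children.1 hc').1 s with htip | hw
  · rw [htip]
  · exact (h.adm.top.pos_lt (h.blocks s _ hw).1).le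

lemma pos_tip_opp_le (h : Branching E K T c S) (hT₁ : LoopState E K T c done T₁)
    (hc' : c' ∈ c.children T S) (s : Side) :
    pos s T₁ (c'.tip s.opp) ≤ pos s T (c.tip s.opp) := by
  simpa using h.pos_tip_le hT₁ hc' s.opp

lemma len_le (h : Branching E K T c S) (hT₁ : LoopState E K T c done T₁)
    (hc' : c' ∈ c.children T S) : c'.len T₁ ≤ c.len T := by
  rw [c.len_eq T .lower, c'.len_eq T₁ .lower]
  linarith [h.pos_tip_le hT₁ hc' .lower, h.pos_tip_opp_le hT₁ hc' .lower]

lemma blocks_of_blocks (h : Branching E K T c S) (hT₁ : LoopState E K T c done T₁)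
    (hc' : c' ∈ c.children T S) (htip : c'.tip s = c.tip s) (hw : Blocks E s T₁ c' w) :
    Blocks E s T c w := by
  obtain ⟨hadj, hlt⟩ := hw
  rw [htip] at hadj
  refine ⟨hadj, not_le.1 fun hge => ?_⟩
  have hne : w ≠ c.tip s.opp :=
    h.cones.ne (h.cones.closed (h.adm.cone s) hadj) (h.adm.cone s.opp)
  have hgt : pos s T (c.tip s.opp) < pos s T w :=
    hge.lt_of_ne fun he => hne (T.injective (pos_inj.1 he)).symm
  have hfix : T₁ w = T w := hT₁.fixes s.opp w (by simpa using hgt)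
  rw [pos_inj.2 hfix] at hlt
  linarith [h.pos_tip_opp_le hT₁ hc' s]

lemma admissible_child (h : Branching E K T c S) (hT₁ : LoopState E K T c done T₁)
    (hc' : c' ∈ c.children T S) : Admissible E K T₁ c' where
  top := hT₁.reach.isTopOrder h.cones h.adm.top
  cone := h.cone_of_mem hc'
  clear s hflag w hw := by
    obtain ⟨htip, hempty⟩ := ((mem_children.1 hc').2.2 s).1 hflag
    exact h.clear s hempty w (h.blocks_of_blocks hT₁ hc' htip hw)

lemma loopState_append (h : Branching E K T c S) (hT₁ : LoopState E K T c done T₁)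
    (hdone : done ⊆ c.children T S) (hc' : c' ∈ c.children T S) (hR : Resolves E K T₁ c' T₂) :
    LoopState E K T c (done ++ [c']) T₂ where
  reach := hT₁.reach.trans hR.reach
  fixes s x hx := by
    have hfix := hT₁.fixes s x hx
    rw [← hfix]
    exact hR.fixes s x ((pos_inj.2 hfix).trans_lt (hx.trans_le (h.pos_tip_le hT₁ hc' s)))
  resolved d hd := by
    rcases List.mem_append.1 hd with hd | hd
    · have hu := hR.reach.pos_le h.cones (h.cone_of_mem (hdone hd) .lower)
      have hv := hR.reach.pos_ge (s := .lower) h.cones (h.cone_of_mem (hdone hd) .upper)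
      exact pos_lower_lt.1 (hv.trans_lt ((pos_lower_lt.2 (hT₁.resolved d hd)).trans_le hu))
    · exact List.mem_singleton.1 hd ▸ hR.sep

lemma loop (h : Branching E K T c S)
    (hs : Steps (fun T c T' L => Admissible E K T c → R T c T' L) T (c.children T S) T' L)
    (hR : ∀ T c T' L, R T c T' L → Resolves E K T c T') :
    Steps (fun T₁ c' T₂ L => LoopStep E K T c S T₁ c' T₂ ∧ R T₁ c' T₂ L) T (c.children T S) T' L ∧
      LoopState E K T c (c.children T S) T' := by
  refine hs.induction_on_done (LoopState.nil E K T c) fun done c' rest T₁ T₂ L₁ hcs hT₁ hstep => ?_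
  have hc' : c' ∈ c.children T S := by simp [hcs]
  have hdone : done ⊆ c.children T S := by simp [hcs]
  have hR₁ := hstep (h.admissible_child hT₁ hc')
  exact ⟨⟨⟨hR _ _ _ _ hR₁, done, rest, hcs, hT₁⟩, hR₁⟩,
    h.loopState_append hT₁ hdone hc' (hR _ _ _ _ hR₁)⟩

lemma clear_child (h : Branching E K T c S) (hfull : ∀ w, Blocks E s T c w → w ∈ S s)
    (hstep : LoopStep E K T c S T₁ c' T₂) (htip : c'.tip s = c.tip s) : Clear E s T₁ c' := by
  obtain ⟨-, done, rest, hcs, hT₁⟩ := hstep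
  have hc' : c' ∈ c.children T S := by simp [hcs]
  -- An earlier call of the loop has moved every such `w` past the other end of `c'`.
  intro w hw
  have hwT := h.blocks_of_blocks hT₁ hc' htip hw
  have hup : pos s T w < pos s T (c'.tip s.opp) :=
    calc pos s T w ≤ pos s T₁ w :=
          hT₁.reach.pos_le h.cones (h.cones.closed (h.adm.cone s) hwT.1)
      _ < pos s T₁ (c'.tip s.opp) := hw.2
      _ ≤ pos s T (c'.tip s.opp) := hT₁.reach.pos_ge h.cones (h.cone_of_mem hc' s.opp)
  obtain ⟨d, hd, hds, hds'⟩ :=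
    exists_mem_done hcs htip (hfull w hwT) (h.adm.top.pos_lt hwT.1) hup
  have hlt := pos_tip_opp_lt_pos_tip (s := s).2 (hT₁.resolved d hd)
  rw [hds, hds'] at hlt
  exact hlt.not_gt hw.2

lemma le_pos_tip_step (h : Branching E K T c S) (hfull : ∀ w, Blocks E s T c w → w ∈ S s)
    (hm : ∀ w ∈ S s, m ≤ pos s T w) (hstep : LoopStep E K T c S T₁ c' T₂)
    (hJ : m ≤ pos s T₁ (c.tip s.opp) ∨ m ≤ pos s T₁ (c.tip s)) :
    m ≤ pos s T₂ (c.tip s.opp) ∨ m ≤ pos s T₂ (c.tip s) := by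
  have hclear := h.clear_child hfull hstep
  obtain ⟨hR, done, rest, hcs, hT₁⟩ := hstep
  have hc' : c' ∈ c.children T S := by simp [hcs]
  have hmono : m ≤ pos s T₁ (c.tip s) → m ≤ pos s T₂ (c.tip s) := fun hle =>
    hle.trans (hR.reach.pos_le h.cones (h.adm.cone s))
  rcases hJ with hJ | hJ
  swap
  · exact .inr (hmono hJ)
  rcases (mem_children.1 hc').1 s.opp with hopp | hopp
  swap
  · have htop := (h.admissible_child hT₁ hc').top
    have hfix := hR.fixes s.opp _ (htop.pos_lt (h.blocks s.opp _ hopp).1)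
    exact .inl (hJ.trans_eq (pos_inj.2 hfix.symm))
  rcases (mem_children.1 hc').1 s with htip | hw
  · rcases lt_or_ge (T₁ c'.u) (T₁ c'.v) with hlt | hge
    · have hcross := hR.cross s (hclear htip) hlt
      rw [htip, hopp] at hcross
      exact .inr (hJ.trans_eq (pos_inj.2 hcross.symm))
    · have hle := pos_tip_opp_le_pos_tip (s := s).2 hge
      rw [htip, hopp] at hle
      exact .inr (hmono (hJ.trans hle))
  · have hmw : m ≤ pos s T₁ (c'.tip s) :=
      (hm _ hw).trans (hT₁.reach.pos_le h.cones (h.cone_of_mem hc' s))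
    rcases lt_or_ge (pos s T₁ (c.tip s.opp)) (pos s T₁ (c'.tip s)) with hlt | hge
    · exact .inl (hJ.trans_eq (pos_inj.2 (hR.fixes s _ hlt).symm))
    · exact .inl (hmw.trans (hR.fixes.le_pos hge))

lemma tip_resolved (h : Branching E K T c S) (hT' : LoopState E K T c (c.children T S) T') :
    T' c.v < T' c.u := by
  obtain ⟨d, hd, htips⟩ := exists_mem_children (S := S) (x := c.tip) (fun _ => .inl rfl) h.lt
  have hlt := hT'.resolved d hd
  rwa [show d.u = c.u from htips .lower, show d.v = c.v from htips .upper] at hlt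

lemma le_pos_tip (h : Branching E K T c S) (hfull : ∀ w, Blocks E s T c w → w ∈ S s)
    (hm : ∀ w ∈ S s, m ≤ pos s T w) (hm' : m ≤ pos s T (c.tip s.opp))
    (hs : Steps (fun T₁ c' T₂ L => LoopStep E K T c S T₁ c' T₂ ∧ R T₁ c' T₂ L) T
      (c.children T S) T' L)
    (hT' : LoopState E K T c (c.children T S) T') : m ≤ pos s T' (c.tip s) := by
  have hJ := hs.invariant (I := fun T₁ => m ≤ pos s T₁ (c.tip s.opp) ∨ m ≤ pos s T₁ (c.tip s))
    (.inl hm') fun _ _ _ _ hstep => h.le_pos_tip_step hfull hm hstep.1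
  exact hJ.elim (·.trans (pos_tip_opp_lt_pos_tip.2 (h.tip_resolved hT')).le) id

lemma resolves (h : Branching E K T c S)
    (hs : Steps (fun T₁ c' T₂ L => LoopStep E K T c S T₁ c' T₂ ∧ R T₁ c' T₂ L) T
      (c.children T S) T' L)
    (hT' : LoopState E K T c (c.children T S) T') : Resolves E K T c T' where
  reach := hT'.reach
  fixes := hT'.fixes
  sep := h.tip_resolved hT'
  cross s hclear hlt := by
    have hle : pos s T (c.tip s.opp) ≤ pos s T' (c.tip s) :=
      h.le_pos_tip (fun w hw => absurd hw (hclear w))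
        (fun w hw => absurd (h.blocks s w hw) (hclear w)) le_rfl hs hT'
    have hge := hT'.fixes.pos_le (pos_tip_lt_pos_tip_opp (s := s).2 hlt).le
    exact pos_inj.1 (hge.antisymm hle)

open Classical in
lemma legalSwap (h : Branching E K T c S) (hS : ∀ s, S s = ∅) :
    LegalSwap E K T c ((Equiv.swap c.u c.v).trans T) where
  cone := h.adm.cone
  lt := h.lt
  clear s := h.clear s (hS s)
  eq := rfl

end Branching

end Branching

section Execution

variable {V : Type*} [Fintype V] {n : ℕ} {E : V → V → Prop} {K : Side → Set V} {t : ℕ → ℝ}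
  {p depth : ℕ} {T T' : Order V n} {c : Call V} {L : List (CallRecord V)}

lemma branching_chosen (hK : Cones E K) (hp : (n : ℝ) ≤ t (p + 1)) (hadm : Admissible E K T c)
    (hc : T c.u < T c.v) : Branching E K T c (chosen E p t T c) where
  cones := hK
  adm := hadm
  lt := hc
  blocks _ _ hw := blocks_of_mem_chosen hadm.top hw
  clear s hs := clear_of_chosen_eq_empty hadm.top hp hc (hadm.clear s) hs

lemma reorder_induction {R : Order V n → Call V → Order V n → List (CallRecord V) → Prop}
    (hK : Cones E K) (hp : (n : ℝ) ≤ t (p + 1))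
    (exit : ∀ T c, Admissible E K T c → T c.v ≤ T c.u → R T c T [⟨c, ∅, ∅⟩])
    (swap : ∀ T c T', IsTopOrder E T → LegalSwap E K T c T' → R T c T' [record E p t T c])
    (branch : ∀ T c T' L, Branching E K T c (chosen E p t T c) →
      Steps (fun T c T' L => Admissible E K T c → R T c T' L) T
        (c.children T (chosen E p t T c)) T' L →
      R T c T' (record E p t T c :: L))
    (h : reorder E p t depth T c = some (T', L)) (hadm : Admissible E K T c) : R T c T' L := by
  induction depth generalizing T c T' L with
  | zero => exact absurd h (by simp [reorder])
  | succ depth ih =>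
    rcases le_or_gt (T c.v) (T c.u) with hc | hc
    · rw [reorder_of_le hc] at h
      cases h
      exact exit T c hadm hc
    have hbranch := branching_chosen hK hp hadm hc
    by_cases hempty : ∀ s, chosen E p t T c s = ∅
    · rw [reorder_of_chosen_eq_empty hc hempty] at h
      cases h
      exact swap T c _ hadm.top (hbranch.legalSwap hempty)
    · obtain ⟨s, hs⟩ := not_forall.1 hempty
      rw [reorder_of_chosen_ne_empty hc hs, Option.map_eq_some_iff] at h
      obtain ⟨⟨T', L⟩, hrun, hout⟩ := h
      cases hout
      exact branch T c T' L hbranch ((steps_of_runCalls hrun).mono fun _ _ _ _ => ih)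

lemma reorder_resolves (hK : Cones E K) (hp : (n : ℝ) ≤ t (p + 1))
    (h : reorder E p t depth T c = some (T', L)) (hadm : Admissible E K T c) :
    Resolves E K T c T' := by
  refine reorder_induction (R := fun T c T' _ => Resolves E K T c T') hK hp
    (fun _ _ => Admissible.resolves_of_le hK) (fun _ _ _ _ => LegalSwap.resolves) ?_ h hadm
  intro T c T' L hbranch hs
  obtain ⟨hsteps, hT'⟩ := hbranch.loop hs fun _ _ _ _ => id
  exact hbranch.resolves hsteps hT'

end Execution

section Termination

variable {V : Type*} {n : ℕ} {E : V → V → Prop} {K : Side → Set V} {t : ℕ → ℝ}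
  {p : ℕ} {T : Order V n} {c : Call V} {α β : Type*}

/-- A computation depending on a bound for the depth of the recursion terminates if it gives one
and the same result for all sufficiently large bounds. -/
def Terminates (f : ℕ → Option α) : Prop :=
  ∃ r, ∀ᶠ depth in Filter.atTop, f depth = some r

namespace Terminates

lemma const (r : α) : Terminates fun _ => some r := ⟨r, .of_forall fun _ => rfl⟩

lemma of_succ {f : ℕ → Option α} (h : Terminates fun depth => f (depth + 1)) : Terminates f := by
  obtain ⟨r, hr⟩ := h
  refine ⟨r, ?_⟩
  rw [← Filter.map_add_atTop_eq_nat 1]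
  exact hr

lemma map {f : ℕ → Option α} (h : Terminates f) (g : α → β) :
    Terminates fun depth => (f depth).map g := by
  obtain ⟨r, hr⟩ := h
  exact ⟨g r, hr.mono fun depth hd => by simp only [hd, Option.map_some]⟩

lemma bind {f : ℕ → Option α} {g : ℕ → α → Option β} (hf : Terminates f)
    (hg : ∀ depth r, f depth = some r → Terminates fun depth => g depth r) :
    Terminates fun depth => (f depth).bind (g depth) := by
  obtain ⟨r, hr⟩ := hf
  obtain ⟨depth, hdepth⟩ := hr.exists
  obtain ⟨r', hr'⟩ := hg depth r hdepth
  exact ⟨r', (hr.and hr').mono fun d hd => by simp only [hd.1, Option.bind_some, hd.2]⟩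

end Terminates

lemma terminates_runCalls {exec : ℕ → Order V n → Call V → Option (Outcome V n)}
    {I : List (Call V) → Order V n → Prop} {cs : List (Call V)} (hT : I [] T)
    (hexec : ∀ l c l' T₁, cs = l ++ c :: l' → I l T₁ → Terminates fun depth => exec depth T₁ c)
    (hI : ∀ l c l' T₁ depth r, cs = l ++ c :: l' → I l T₁ → exec depth T₁ c = some r →
      I (l ++ [c]) r.1) :
    Terminates fun depth => runCalls (exec depth) T cs := by
  induction cs generalizing T I with
  | nil => exact .const _
  | cons c cs ih =>
    refine (hexec [] c cs T rfl hT).bind fun depth r hr => Terminates.map ?_ _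
    exact ih (I := fun l => I (c :: l)) (hI [] c cs T depth r rfl hT hr)
      (fun l d l' T₁ hl => hexec (c :: l) d l' T₁ (by rw [hl, List.cons_append]))
      (fun l d l' T₁ depth r hl => hI (c :: l) d l' T₁ depth r (by rw [hl, List.cons_append]))

lemma Branching.len_lt {c' : Call V} {rest : List (Call V)} {S : Side → Finset V} {s : Side}
    (h : Branching E K T c S) (hcs : c.children T S = c' :: rest) (hs : S s ≠ ∅) :
    c'.len T < c.len T := by
  have hc' : c' ∈ c.children T S := by simp [hcs]
  have hT := LoopState.nil E K T c
  obtain ⟨r, hr⟩ : ∃ r, c'.tip r ≠ c.tip r := by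
    by_contra! htip
    obtain ⟨w, hw⟩ := Finset.nonempty_iff_ne_empty.2 hs
    obtain ⟨hadj, hlt⟩ := h.blocks s w hw
    obtain ⟨d, hd, -⟩ := exists_mem_done (done := []) hcs (htip s) hw (h.adm.top.pos_lt hadj)
      (by rwa [htip])
    exact List.not_mem_nil hd
  have hmem : c'.tip r ∈ S r := ((mem_children.1 hc').1 r).resolve_left hr
  rw [c.len_eq T r, c'.len_eq T r]
  linarith [h.adm.top.pos_lt (h.blocks r _ hmem).1, h.pos_tip_opp_le hT hc' r]

variable [Fintype V]

lemma terminates_reorder_of_children (hK : Cones E K) (hp : (n : ℝ) ≤ t (p + 1))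
    (hadm : Admissible E K T c)
    (hlater : ∀ T₁ d, Relation.TransGen (SwapStep E K) T T₁ → Admissible E K T₁ d →
      Terminates fun depth => reorder E p t depth T₁ d)
    (hshorter : ∀ d, T d.u < T d.v → d.len T < c.len T → Admissible E K T d →
      Terminates fun depth => reorder E p t depth T d) :
    Terminates fun depth => reorder E p t depth T c := by
  refine .of_succ ?_
  rcases le_or_gt (T c.v) (T c.u) with hc | hc
  · simpa only [reorder_of_le hc] using Terminates.const _
  by_cases hempty : ∀ s, chosen E p t T c s = ∅
  · simpa only [reorder_of_chosen_eq_empty hc hempty] using Terminates.const _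
  obtain ⟨s, hs⟩ := not_forall.1 hempty
  have hbranch := branching_chosen hK hp hadm hc
  simp only [reorder_of_chosen_ne_empty hc hs]
  refine .map (terminates_runCalls
    (I := fun done T₁ => LoopState E K T c done T₁ ∧ (done = [] → T₁ = T))
    ⟨LoopState.nil E K T c, fun _ => rfl⟩ ?_ ?_) _
  · rintro (_ | ⟨d, done⟩) c' rest T₁ hcs ⟨hT₁, hnil⟩
    all_goals
      have hc' : c' ∈ c.children T (chosen E p t T c) := by simp [hcs]
      have hadm' := hbranch.admissible_child hT₁ hc'
    · obtain rfl := hnil rfl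
      exact hshorter c' (mem_children.1 hc').2.1 (hbranch.len_lt hcs hs) hadm'
    · have hd : d ∈ c.children T (chosen E p t T c) := by simp [hcs]
      exact hlater T₁ c' (hT₁.transGen List.mem_cons_self (mem_children.1 hd).2.1) hadm'
  · rintro done c' rest T₁ depth ⟨T₂, L⟩ hcs ⟨hT₁, -⟩ hrun
    have hc' : c' ∈ c.children T (chosen E p t T c) := by simp [hcs]
    have hR := reorder_resolves hK hp hrun (hbranch.admissible_child hT₁ hc')
    exact ⟨hbranch.loopState_append hT₁ (by simp [hcs]) hc' hR, by simp⟩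

theorem terminates_reorder (hK : Cones E K) (hp : (n : ℝ) ≤ t (p + 1))
    (hadm : Admissible E K T c) : Terminates fun depth => reorder E p t depth T c := by
  induction T using (wellFounded_transGen_swapStep hK).induction generalizing c with
  | _ T ihT =>
    induction hm : (T c.v : ℕ) - (T c.u : ℕ) using Nat.strong_induction_on generalizing c with
    | _ m ihm =>
      refine terminates_reorder_of_children hK hp hadm (fun T₁ d hT₁ => ihT T₁ hT₁)
        fun d hd hlen hadm' => ihm _ ?_ hadm' rfl
      have hsum : (T d.v : ℕ) + (T c.u : ℕ) < (T c.v : ℕ) + (T d.u : ℕ) := by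
        simp only [Call.len, pos] at hlen
        exact_mod_cast (by linarith : ((T d.v : ℕ) : ℝ) + (T c.u : ℕ) < (T c.v : ℕ) + (T d.u : ℕ))
      rw [Fin.lt_def] at hd
      omega

end Termination

section Counting

variable {V : Type*} {n : ℕ} {E : V → V → Prop} {K : Side → Set V} {T T₁ T₂ T' : Order V n}
  {c c' : Call V} {S : Side → Finset V} {s : Side} {i p depth : ℕ} {t : ℕ → ℝ}
  {cs : List (Call V)} {L : List (CallRecord V)} {Ω : Order V n → ℝ} {a b : ℝ}

/-- The number of recorded calls that compute both `Â_i` and `Â_{i+1}` (on the lower side) or both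
`B̂_i` and `B̂_{i+1}` (on the upper side). -/
def countBoth : Side → ℕ → List (CallRecord V) → ℕ
  | .lower => countBothA
  | .upper => countBothB

lemma countBoth_nil (s : Side) (i : ℕ) : countBoth s i ([] : List (CallRecord V)) = 0 := by
  cases s <;> rfl

lemma countBoth_append (s : Side) (i : ℕ) (L₁ L₂ : List (CallRecord V)) :
    countBoth s i (L₁ ++ L₂) = countBoth s i L₁ + countBoth s i L₂ := by
  cases s <;> exact List.countP_append

lemma countBoth_exit (s : Side) (i : ℕ) (c : Call V) : countBoth s i [⟨c, ∅, ∅⟩] = 0 := by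
  cases s <;> simp [countBoth, countBothA, countBothB]

lemma countBoth_record_cons [Fintype V] (s : Side) (i : ℕ) (L : List (CallRecord V)) :
    countBoth s i (record E p t T c :: L) = countBoth s i L +
      if i ∈ computed E p t T c s ∧ i + 1 ∈ computed E p t T c s then 1 else 0 := by
  cases s <;> simp [countBoth, countBothA, countBothB, List.countP_cons, record]

lemma mul_countBoth_le_of_steps {f : Order V n → ℝ}
    (hs : Steps (fun T _ T' L => a * countBoth s i L ≤ f T' - f T) T cs T' L) :
    a * countBoth s i L ≤ f T' - f T := by
  induction cs generalizing T L with
  | nil =>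
    obtain ⟨rfl, rfl⟩ := hs
    simp [countBoth_nil]
  | cons c cs ih =>
    obtain ⟨T₁, L₁, L₂, hc, hcs, rfl⟩ := hs
    rw [countBoth_append]
    push_cast
    linarith [ih hcs]

/-- A potential on the orders that no legal swap lowers, and that rises at least by the distance of
the swapped vertices whenever this distance is at most `b`. -/
def IsWeight (E : V → V → Prop) (K : Side → Set V) (b : ℝ) (Ω : Order V n → ℝ) : Prop :=
  ∀ T c T', IsTopOrder E T → LegalSwap E K T c T' →
    Ω T ≤ Ω T' ∧ (c.len T ≤ b → c.len T ≤ Ω T' - Ω T)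

lemma IsWeight.le_of_reach (hΩ : IsWeight E K b Ω) (hK : Cones E K) (hT : IsTopOrder E T)
    (h : Reach E K T T') : Ω T ≤ Ω T' := by
  induction h with
  | refl => exact le_rfl
  | tail hreach hstep ih =>
    exact ih.trans (hΩ _ _ _ (Reach.isTopOrder hK hreach hT) hstep.choose_spec).1

/-- How the double computations recorded in `L` on the side `s` at the level `i`, during the
execution of the call `c` from `T` to `T'`, and the move of the end `c.tip s` are paid for by the
potential `Ω`. -/
structure Counted (E : V → V → Prop) (t : ℕ → ℝ) (s : Side) (i : ℕ) (Ω : Order V n → ℝ)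
    (T : Order V n) (c : Call V) (T' : Order V n) (L : List (CallRecord V)) : Prop where
  count_le : t i * countBoth s i L ≤ 2 * (Ω T' - Ω T)
  count_eq_zero : c.flag s = true → countBoth s i L = 0
  count_le_of_clear : Clear E s T c → t i * countBoth s i L ≤ Ω T' - Ω T
  move_le : Clear E s T c → c.len T ≤ t (i + 1) →
    pos s T' (c.tip s) - pos s T (c.tip s) ≤ Ω T' - Ω T

lemma counted_exit : Counted E t s i Ω T c T [⟨c, ∅, ∅⟩] where
  count_le := by simp [countBoth_exit]
  count_eq_zero _ := countBoth_exit s i c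
  count_le_of_clear _ := by simp [countBoth_exit]
  move_le _ _ := by simp

lemma LegalSwap.counted [Fintype V] (hΩ : IsWeight E K (t (i + 1)) Ω) (hT : IsTopOrder E T)
    (h : LegalSwap E K T c T') : Counted E t s i Ω T c T' [record E p t T c] := by
  obtain ⟨hmono, hgain⟩ := hΩ T c T' hT h
  have hcount : t i * countBoth s i [record E p t T c] ≤ Ω T' - Ω T := by
    rw [countBoth_record_cons, countBoth_nil, zero_add]
    split_ifs with hi
    · have hd := doubleScan_of_mem_computed hT h.lt hi.1 hi.2
      simpa using hd.lt_len.le.trans (hgain hd.len_le)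
    · simpa using hmono
  refine ⟨by linarith, fun hflag => ?_, fun _ => hcount, fun _ hlen => ?_⟩
  · rw [countBoth_record_cons, countBoth_nil, if_neg]
    intro hi
    simp [(doubleScan_of_mem_computed hT h.lt hi.1 hi.2).flag] at hflag
  · rw [pos_inj.2 (h.apply_tip s), ← c.len_eq]
    exact hgain hlen

namespace Branching

lemma move_step (h : Branching E K T c S) (hΩ : IsWeight E K (t (i + 1)) Ω)
    (hfull : ∀ w, Blocks E s T c w → w ∈ S s) (hlen : c.len T ≤ t (i + 1))
    (hstep : LoopStep E K T c S T₁ c' T₂) (hcount : Counted E t s i Ω T₁ c' T₂ L) :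
    pos s T₂ (c.tip s) - pos s T₁ (c.tip s) ≤ Ω T₂ - Ω T₁ ∧
      pos s T₂ (c.tip s) - pos s T₁ (c.tip s) + t i * countBoth s i L ≤ 2 * (Ω T₂ - Ω T₁) := by
  have hclear := h.clear_child hfull hstep
  obtain ⟨hR, done, rest, hcs, hT₁⟩ := hstep
  have hc' : c' ∈ c.children T S := by simp [hcs]
  by_cases htip : c'.tip s = c.tip s
  · have hmove := hcount.move_le (hclear htip) ((h.len_le hT₁ hc').trans hlen)
    rw [htip] at hmove
    exact ⟨hmove, by linarith [hcount.count_le_of_clear (hclear htip)]⟩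
  · have hw := ((mem_children.1 hc').1 s).resolve_left htip
    have htop := (h.admissible_child hT₁ hc').top
    have hfix := hR.fixes s _ (htop.pos_lt (h.blocks s _ hw).1)
    rw [pos_inj.2 hfix, sub_self, zero_add, sub_nonneg]
    exact ⟨hΩ.le_of_reach h.cones htop hR.reach, hcount.count_le⟩

lemma move_le (h : Branching E K T c S) (hΩ : IsWeight E K (t (i + 1)) Ω)
    (hfull : ∀ w, Blocks E s T c w → w ∈ S s) (hlen : c.len T ≤ t (i + 1))
    (hs : Steps (fun T₁ c' T₂ L => LoopStep E K T c S T₁ c' T₂ ∧ Counted E t s i Ω T₁ c' T₂ L) T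
      (c.children T S) T' L) :
    pos s T' (c.tip s) - pos s T (c.tip s) ≤ Ω T' - Ω T := by
  -- With `a = 0`, summation over the steps is the telescoping of `f`.
  have hsum := mul_countBoth_le_of_steps (a := 0) (s := s) (i := i)
    (f := fun T => Ω T - pos s T (c.tip s)) <| hs.mono fun _ _ _ _ hstep => by
      linarith [(h.move_step hΩ hfull hlen hstep.1 hstep.2).1]
  linarith

lemma move_add_count_le (h : Branching E K T c S) (hΩ : IsWeight E K (t (i + 1)) Ω)
    (hfull : ∀ w, Blocks E s T c w → w ∈ S s) (hlen : c.len T ≤ t (i + 1))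
    (hs : Steps (fun T₁ c' T₂ L => LoopStep E K T c S T₁ c' T₂ ∧ Counted E t s i Ω T₁ c' T₂ L) T
      (c.children T S) T' L) :
    pos s T' (c.tip s) - pos s T (c.tip s) + t i * countBoth s i L ≤ 2 * (Ω T' - Ω T) := by
  have hsum := mul_countBoth_le_of_steps (a := t i) (s := s) (i := i)
    (f := fun T => 2 * Ω T - pos s T (c.tip s)) <| hs.mono fun _ _ _ _ hstep => by
      linarith [(h.move_step hΩ hfull hlen hstep.1 hstep.2).2]
  linarith

lemma move_of_doubleScan (h : Branching E K T c S) (hd : DoubleScan E t T c s i (S s))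
    (hs : Steps (fun T₁ c' T₂ L => LoopStep E K T c S T₁ c' T₂ ∧ Counted E t s i Ω T₁ c' T₂ L) T
      (c.children T S) T' L)
    (hT' : LoopState E K T c (c.children T S) T') :
    t i ≤ pos s T' (c.tip s) - pos s T (c.tip s) := by
  refine le_sub_iff_add_le'.2 (h.le_pos_tip hd.full (fun w hw => ?_) ?_ hs hT')
  · linarith [hd.far w hw]
  · linarith [hd.lt_len, c.len_eq T s]

lemma eq_empty_of_clear (h : Branching E K T c S) (hclear : Clear E s T c) : S s = ∅ :=
  Finset.eq_empty_of_forall_notMem fun w hw => hclear w (h.blocks s w hw)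

end Branching

lemma countBoth_eq_zero_of_eq_empty (hS : S s = ∅)
    (hs : Steps (fun T₁ c' T₂ L => LoopStep E K T c S T₁ c' T₂ ∧ Counted E t s i Ω T₁ c' T₂ L) T
      (c.children T S) T' L) : countBoth s i L = 0 := by
  have hsum := mul_countBoth_le_of_steps (a := 1) (s := s) (i := i) (f := fun _ => 0) <|
    hs.mono fun T₁ c' T₂ L₁ hstep => by
      obtain ⟨⟨-, done, rest, hcs, -⟩, hcount⟩ := hstep
      obtain ⟨htip, -, hflag⟩ := mem_children.1 (by simp [hcs] : c' ∈ c.children T S)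
      have htip' : c'.tip s = c.tip s := (htip s).resolve_right (by simp [hS])
      simp [hcount.count_eq_zero ((hflag s).2 ⟨htip', hS⟩)]
  simpa using hsum

variable [Fintype V]

lemma Branching.counted (h : Branching E K T c (chosen E p t T c))
    (hΩ : IsWeight E K (t (i + 1)) Ω)
    (hs : Steps (fun T₁ c' T₂ L =>
      LoopStep E K T c (chosen E p t T c) T₁ c' T₂ ∧ Counted E t s i Ω T₁ c' T₂ L) T
      (c.children T (chosen E p t T c)) T' L)
    (hT' : LoopState E K T c (c.children T (chosen E p t T c)) T') :
    Counted E t s i Ω T c T' (record E p t T c :: L) := by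
  have hdouble (hi : i ∈ computed E p t T c s ∧ i + 1 ∈ computed E p t T c s) :=
    doubleScan_of_mem_computed h.adm.top h.lt hi.1 hi.2
  have hfull (hclear : Clear E s T c) : ∀ w, Blocks E s T c w → w ∈ chosen E p t T c s :=
    fun w hw => absurd hw (hclear w)
  have hzero (hclear : Clear E s T c) : countBoth s i L = 0 :=
    countBoth_eq_zero_of_eq_empty (h.eq_empty_of_clear hclear) hs
  refine ⟨?_, fun hflag => ?_, fun hclear => ?_, fun hclear hlen =>
    h.move_le hΩ (hfull hclear) hlen hs⟩
  · rw [countBoth_record_cons]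
    split_ifs with hi
    · have hd := hdouble hi
      push_cast
      linarith [h.move_add_count_le hΩ hd.full hd.len_le hs, h.move_of_doubleScan hd hs hT']
    · rw [add_zero, mul_sub]
      refine mul_countBoth_le_of_steps (f := fun T => 2 * Ω T) (hs.mono fun _ _ _ _ hstep => ?_)
      linarith [hstep.2.count_le]
  · rw [countBoth_record_cons, hzero (h.adm.clear s hflag), if_neg]
    intro hi
    simp [(hdouble hi).flag] at hflag
  · rw [countBoth_record_cons, hzero hclear, zero_add]
    split_ifs with hi
    · have hd := hdouble hi
      rw [Nat.cast_one, mul_one]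
      exact (h.move_of_doubleScan hd hs hT').trans (h.move_le hΩ hd.full hd.len_le hs)
    · simpa using hΩ.le_of_reach h.cones h.adm.top hT'.reach

lemma reorder_counted (hK : Cones E K) (hp : (n : ℝ) ≤ t (p + 1))
    (hΩ : IsWeight E K (t (i + 1)) Ω) (h : reorder E p t depth T c = some (T', L))
    (hadm : Admissible E K T c) : Counted E t s i Ω T c T' L := by
  refine (reorder_induction (R := fun T c T' L => Resolves E K T c T' ∧ Counted E t s i Ω T c T' L)
    hK hp (fun T c hadm hc => ⟨hadm.resolves_of_le hK hc, counted_exit⟩)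
    (fun T c T' hT hswap => ⟨hswap.resolves, hswap.counted hΩ hT⟩) ?_ h hadm).2
  intro T c T' L hbranch hs
  obtain ⟨hsteps, hT'⟩ := hbranch.loop hs fun _ _ _ _ => And.left
  exact ⟨hbranch.resolves hsteps hT',
    hbranch.counted hΩ (hsteps.mono fun _ _ _ _ hstep => ⟨hstep.1, hstep.2.2⟩) hT'⟩

end Counting

section Potential

variable {V : Type*} {n : ℕ} {E : V → V → Prop} {K : Side → Set V}
  {F T T' : Order V n} {c : Call V} {b k : ℝ} {R R' : V → V → Prop} {x y : V}

/-- The pairs that are known to stay in increasing order until the end of the insertion of an edge: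
those joined by a path, and those that a swap has brought into the right order. -/
def Settled (E : V → V → Prop) (K : Side → Set V) (T : Order V n) (y x : V) : Prop :=
  Relation.TransGen E y x ∨ (y ∈ K .upper ∧ x ∈ K .lower ∧ T y < T x)

lemma LegalSwap.settled (hK : Cones E K) (h : LegalSwap E K T c T') (hyx : Settled E K T y x) :
    Settled E K T' y x := by
  refine hyx.imp_right fun ⟨hy, hx, hlt⟩ => ⟨hy, hx, pos_lower_lt.1 ?_⟩
  have hy' : pos .lower T' y ≤ pos .lower T y := by simpa [pos] using h.pos_le hK hy
  exact hy'.trans_lt ((pos_lower_lt.2 hlt).trans_le (h.pos_le hK hx))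

variable [Fintype V]

lemma card_eq_of_order (T : Order V n) : Fintype.card V = n := by
  simpa using Fintype.card_congr T

/-- The correlation of the positions in `T` with the positions in the fixed order `F`. -/
noncomputable def correlation (F T : Order V n) : ℝ :=
  ∑ x, pos .lower T x * pos .lower F x

lemma correlation_nonneg (F T : Order V n) : 0 ≤ correlation F T :=
  Finset.sum_nonneg fun _ _ => mul_nonneg (Nat.cast_nonneg _) (Nat.cast_nonneg _)

lemma correlation_le (F T : Order V n) : correlation F T ≤ (n : ℝ) ^ 3 := by
  have hpos (T : Order V n) (x : V) : pos .lower T x ≤ n := Nat.cast_le.2 (T x).2.le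
  calc correlation F T ≤ ∑ _x : V, (n : ℝ) * n :=
        Finset.sum_le_sum fun x _ =>
          mul_le_mul (hpos T x) (hpos F x) (Nat.cast_nonneg _) (Nat.cast_nonneg _)
    _ = (n : ℝ) ^ 3 := by
        rw [Finset.sum_const, Finset.card_univ, card_eq_of_order T, nsmul_eq_mul]
        ring

lemma LegalSwap.correlation_eq (h : LegalSwap E K T c T') (F : Order V n) :
    correlation F T' =
      correlation F T + c.len T * (pos .lower F c.u - pos .lower F c.v) := by
  have hu : pos .lower T' c.u = pos .lower T c.v := pos_inj.2 (h.apply_tip .lower)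
  have hv : pos .lower T' c.v = pos .lower T c.u := pos_inj.2 (h.apply_tip .upper)
  have hsum : ∑ x, (pos .lower T' x - pos .lower T x) * pos .lower F x =
      (pos .lower T' c.u - pos .lower T c.u) * pos .lower F c.u +
        (pos .lower T' c.v - pos .lower T c.v) * pos .lower F c.v := by
    refine Fintype.sum_eq_add _ _ (ne_of_apply_ne T h.lt.ne) fun x hx => ?_
    rw [pos_inj.2 (h.apply_of_ne hx.1 hx.2), sub_self, zero_mul]
  simp only [sub_mul, Finset.sum_sub_distrib] at hsum
  rw [hu, hv] at hsum
  rw [correlation, correlation, Call.len]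
  linarith

open Classical in
/-- The pairs in the relation `R` that are in increasing order in `F`, with positions that differ by
at most `k`. -/
noncomputable def closePairs (F : Order V n) (k : ℝ) (R : V → V → Prop) : Finset (V × V) :=
  {z | F z.1 < F z.2 ∧ pos .lower F z.2 - pos .lower F z.1 ≤ k ∧ R z.1 z.2}

lemma mem_closePairs :
    (x, y) ∈ closePairs F k R ↔ F x < F y ∧ pos .lower F y - pos .lower F x ≤ k ∧ R x y := by
  classical
  simp [closePairs]

lemma closePairs_mono (F : Order V n) (k : ℝ) (h : ∀ x y, R x y → R' x y) :
    closePairs F k R ⊆ closePairs F k R' := by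
  rintro ⟨x, y⟩ hz
  rw [mem_closePairs] at hz ⊢
  exact ⟨hz.1, hz.2.1, h _ _ hz.2.2⟩

lemma card_closePairs_le (F : Order V n) (hk : 0 ≤ k) (R : V → V → Prop) :
    ((closePairs F k R).card : ℝ) ≤ n * k := by
  have hcard : (closePairs F k R).card ≤
      ((Finset.univ : Finset V) ×ˢ Finset.Icc 1 ⌊k⌋₊).card := by
    refine Finset.card_le_card_of_injOn (fun z => (z.1, (F z.2 : ℕ) - (F z.1 : ℕ))) ?_ ?_
    · rintro ⟨x, y⟩ hz
      obtain ⟨hlt, hle, -⟩ := mem_closePairs.1 hz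
      simp only [pos] at hle
      rw [← Nat.cast_sub hlt.le] at hle
      simpa only [Finset.coe_product, Finset.coe_univ, Finset.coe_Icc, Set.mem_prod,
        Set.mem_univ, Set.mem_Icc, true_and] using ⟨Nat.sub_pos_of_lt hlt, Nat.le_floor hle⟩
    · rintro ⟨x, y⟩ hz ⟨x', y'⟩ hz' heq
      obtain ⟨hx, hdiff⟩ := Prod.mk.inj heq
      obtain rfl : x = x' := hx
      have hsub : (F y : ℕ) - F x = F y' - F x := hdiff
      have hlt : (F x : ℕ) < F y := (mem_closePairs.1 hz).1
      have hlt' : (F x : ℕ) < F y' := (mem_closePairs.1 hz').1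
      rw [F.injective (Fin.ext (by omega) : F y = F y')]
  rw [Finset.card_product, Finset.card_univ, card_eq_of_order F, Nat.card_Icc,
    Nat.add_sub_cancel] at hcard
  calc ((closePairs F k R).card : ℝ) ≤ n * (⌊k⌋₊ : ℝ) := by exact_mod_cast hcard
    _ ≤ n * k := mul_le_mul_of_nonneg_left (Nat.floor_le hk) (Nat.cast_nonneg n)

/-- The potential of the order `T` with respect to the fixed order `F`, if the pairs in `R` are
those whose order will not change any more. -/
noncomputable def potential (F : Order V n) (b k : ℝ) (R : V → V → Prop) (T : Order V n) : ℝ :=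
  b * (closePairs F k R).card + correlation F T / k

lemma potential_nonneg (F T : Order V n) (hb : 0 ≤ b) (hk : 0 ≤ k) (R : V → V → Prop) :
    0 ≤ potential F b k R T :=
  add_nonneg (mul_nonneg hb (Nat.cast_nonneg _)) (div_nonneg (correlation_nonneg F T) hk)

lemma potential_mono (F T : Order V n) (hb : 0 ≤ b) (k : ℝ) (h : ∀ x y, R x y → R' x y) :
    potential F b k R T ≤ potential F b k R' T :=
  add_le_add_left (mul_le_mul_of_nonneg_left
    (Nat.cast_le.2 (Finset.card_le_card (closePairs_mono F k h))) hb) _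

lemma potential_le (F T : Order V n) (hb : 0 < b) (R : V → V → Prop) :
    potential F b (n / √b) R T ≤ 2 * ((n : ℝ) ^ 2 * √b) := by
  have : 0 < √b := Real.sqrt_pos.2 hb
  have hpairs : b * ((closePairs F (n / √b) R).card : ℝ) ≤ (n : ℝ) ^ 2 * √b :=
    calc b * ((closePairs F (n / √b) R).card : ℝ)
        ≤ b * (n * (n / √b)) := by gcongr; exact card_closePairs_le F (by positivity) R
      _ = √b * √b * (n * (n / √b)) := by rw [Real.mul_self_sqrt hb.le]
      _ = (n : ℝ) ^ 2 * √b := by field_simp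
  have hcorr : correlation F T / (n / √b) ≤ (n : ℝ) ^ 2 * √b := by
    rcases n.eq_zero_or_pos with rfl | hn
    · simp
    · have : (0 : ℝ) < n := Nat.cast_pos.2 hn
      calc correlation F T / (n / √b)
          ≤ (n : ℝ) ^ 3 / (n / √b) := by gcongr; exact correlation_le F T
        _ = (n : ℝ) ^ 2 * √b := by field_simp
  rw [potential]
  linarith

lemma LegalSwap.card_closePairs_lt (hK : Cones E K) (hT : IsTopOrder E T)
    (h : LegalSwap E K T c T') (hF : F c.v < F c.u)
    (hk : pos .lower F c.u - pos .lower F c.v ≤ k) :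
    (closePairs F k (Settled E K T)).card < (closePairs F k (Settled E K T')).card := by
  refine Finset.card_lt_card ((Finset.ssubset_iff_of_subset
    (closePairs_mono F k fun _ _ => h.settled hK)).2 ⟨(c.v, c.u), ?_, ?_⟩)
  · exact mem_closePairs.2 ⟨hF, hk, .inr ⟨h.cone .upper, h.cone .lower, h.resolves.sep⟩⟩
  · rw [mem_closePairs]
    rintro ⟨-, -, hpath | ⟨-, -, hlt⟩⟩
    exacts [(hT.lt_of_transGen hpath).not_gt h.lt, hlt.not_gt h.lt]

lemma isWeight_potential (hK : Cones E K) (hF : ∀ x ∈ K .lower, ∀ y ∈ K .upper, F y < F x)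
    (hb : 0 ≤ b) (hk : 0 < k) :
    IsWeight E K b fun T => potential F b k (Settled E K T) T := by
  intro T c T' hT h
  have hlt : F c.v < F c.u := hF _ (h.cone .lower) _ (h.cone .upper)
  have hpairs : b * (closePairs F k (Settled E K T)).card ≤
      b * (closePairs F k (Settled E K T')).card :=
    mul_le_mul_of_nonneg_left (Nat.cast_le.2 (Finset.card_le_card
      (closePairs_mono F k fun _ _ => h.settled hK))) hb
  have hgap : 0 < pos .lower F c.u - pos .lower F c.v := sub_pos.2 (pos_lower_lt.2 hlt)
  have hcorr : correlation F T' / k =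
      correlation F T / k + c.len T * ((pos .lower F c.u - pos .lower F c.v) / k) := by
    rw [h.correlation_eq F, add_div, mul_div_assoc]
  have hlen := Call.len_pos h.lt
  have hgain : 0 < c.len T * ((pos .lower F c.u - pos .lower F c.v) / k) :=
    mul_pos hlen (div_pos hgap hk)
  simp only [potential]
  refine ⟨by linarith, fun hb' => ?_⟩
  rcases le_or_gt (pos .lower F c.u - pos .lower F c.v) k with hclose | hfar
  · have hcard : ((closePairs F k (Settled E K T)).card : ℝ) + 1 ≤
        (closePairs F k (Settled E K T')).card := by
      exact_mod_cast h.card_closePairs_lt hK hT hlt hclose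
    linarith [mul_le_mul_of_nonneg_left hcard hb]
  · linarith [le_mul_of_one_le_right hlen.le ((one_le_div hk).2 hfar.le)]

end Potential

section Insertion

variable {V : Type*} {n : ℕ} {E E' : V → V → Prop} {F T T' : Order V n} {t : ℕ → ℝ} {p i : ℕ}
  {s : Side} {a b x y : V} {depth : ℕ} {edges : List (V × V)} {L : List (CallRecord V)}

/-- The graph after the insertion of the edge `a → b`. -/
abbrev addEdge (E : V → V → Prop) (a b : V) : V → V → Prop := fun x y => E x y ∨ (x = a ∧ y = b)

/-- The graph after the insertion of a list of edges. -/
abbrev addEdges (E : V → V → Prop) (edges : List (V × V)) : V → V → Prop :=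
  fun x y => E x y ∨ (x, y) ∈ edges

lemma addEdges_cons (E : V → V → Prop) (e : V × V) (edges : List (V × V)) :
    addEdges E (e :: edges) = addEdges (addEdge E e.1 e.2) edges := by
  ext x y
  simp [addEdges, addEdge, Prod.ext_iff, or_assoc]

lemma IsTopOrder.mono (hT : IsTopOrder E' T) (h : ∀ x y, E x y → E' x y) : IsTopOrder E T :=
  fun x y hxy => hT x y (h x y hxy)

lemma IsTopOrder.addEdge (hT : IsTopOrder E T) (hab : T a < T b) :
    IsTopOrder (addEdge E a b) T := by
  rintro x y (hxy | ⟨rfl, rfl⟩)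
  exacts [hT x y hxy, hab]

lemma IsTopOrder.le_of_reflTransGen (hT : IsTopOrder E T) (h : Relation.ReflTransGen E x y) :
    T x ≤ T y := by
  rcases Relation.reflTransGen_iff_eq_or_transGen.1 h with rfl | h
  exacts [le_rfl, (hT.lt_of_transGen h).le]

/-- The descendants of the head and the ancestors of the tail of the edge `a → b`. -/
def edgeCone (E : V → V → Prop) (a b : V) : Side → Set V
  | .lower => {x | Relation.ReflTransGen E b x}
  | .upper => {x | Relation.ReflTransGen E x a}

lemma lt_of_mem_edgeCone (hF : IsTopOrder (addEdge E a b) F) :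
    ∀ x ∈ edgeCone E a b .lower, ∀ y ∈ edgeCone E a b .upper, F y < F x := by
  intro x hx y hy
  have hFE : IsTopOrder E F := hF.mono fun _ _ => .inl
  calc F y ≤ F a := hFE.le_of_reflTransGen hy
    _ < F b := hF a b (.inr ⟨rfl, rfl⟩)
    _ ≤ F x := hFE.le_of_reflTransGen hx

lemma cones_edgeCone (hF : IsTopOrder (addEdge E a b) F) : Cones E (edgeCone E a b) where
  closed {s _ _} hx hxy := by
    cases s
    exacts [hx.tail hxy, .head hxy hx]
  disjoint := Set.disjoint_left.2 fun x hx hx' => (lt_of_mem_edgeCone hF x hx x hx').false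

lemma transGen_addEdge_of_settled (h : Settled E (edgeCone E a b) T y x) :
    Relation.TransGen (addEdge E a b) y x := by
  have hle : ∀ x y, E x y → addEdge E a b x y := fun _ _ => .inl
  rcases h with h | ⟨hy, hx, -⟩
  · exact Relation.TransGen.mono hle _ _ h
  · have hy' := Relation.ReflTransGen.mono hle _ _ hy
    have hx' := Relation.ReflTransGen.mono hle _ _ hx
    exact .trans_right hy' (.head' (.inr ⟨rfl, rfl⟩) hx')

lemma admissible_insert (hT : IsTopOrder E T) (a b : V) :
    Admissible E (edgeCone E a b) T ⟨b, a, false, false⟩ where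
  top := hT
  cone := Side.forall_iff.2 ⟨.refl, .refl⟩
  clear := Side.forall_iff.2 ⟨fun h => absurd h Bool.false_ne_true,
    fun h => absurd h Bool.false_ne_true⟩

lemma exists_isTopOrder (hE : Acyclic E) (T : Order V n) : ∃ F : Order V n, IsTopOrder E F := by
  let _ : Fintype V := Fintype.ofEquiv (Fin n) T.symm
  have hpo : IsPartialOrder V (Relation.ReflTransGen E) :=
    { refl := fun _ => .refl
      trans := fun _ _ _ => .trans
      antisymm := fun x y hxy hyx => by
        rcases Relation.reflTransGen_iff_eq_or_transGen.1 hxy with h | h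
        exacts [h.symm, absurd (h.trans_left hyx) (hE x)] }
  obtain ⟨r, hr, hle⟩ := extend_partialOrder (Relation.ReflTransGen E)
  let _ : LinearOrder V :=
    { le := r
      le_refl := hr.refl
      le_trans := hr.trans
      le_antisymm := hr.antisymm
      le_total := hr.total
      toDecidableLE := Classical.decRel _ }
  let e := Fintype.orderIsoFinOfCardEq V (card_eq_of_order T)
  refine ⟨e.symm.toEquiv, fun x y hxy => e.symm.strictMono (lt_of_le_of_ne ?_ ?_)⟩
  · exact hle _ _ (.single hxy)
  · rintro rfl
    exact hE x (.single hxy)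

variable [Fintype V]

lemma insertEdge_eq_some (h : insertEdge E p t depth T a b = some (T', L)) :
    reorder E p t depth T ⟨b, a, false, false⟩ = some (T', L) ∨ T a < T b ∧ T' = T ∧ L = [] := by
  rw [insertEdge] at h
  split_ifs at h with hba
  · exact .inl h
  · cases h
    exact .inr ⟨not_le.1 hba, rfl, rfl⟩

lemma terminates_insertEdge (hp : (n : ℝ) ≤ t (p + 1)) (hT : IsTopOrder E T)
    (hF : IsTopOrder (addEdge E a b) F) :
    Terminates fun depth => insertEdge E p t depth T a b := by
  simp only [insertEdge]
  split_ifs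
  exacts [terminates_reorder (cones_edgeCone hF) hp (admissible_insert hT a b), .const _]

lemma isTopOrder_of_insertEdge (hp : (n : ℝ) ≤ t (p + 1)) (hT : IsTopOrder E T)
    (hF : IsTopOrder (addEdge E a b) F) (h : insertEdge E p t depth T a b = some (T', L)) :
    IsTopOrder (addEdge E a b) T' := by
  rcases insertEdge_eq_some h with h | ⟨hab, rfl, -⟩
  · have hR := reorder_resolves (cones_edgeCone hF) hp h (admissible_insert hT a b)
    exact (hR.reach.isTopOrder (cones_edgeCone hF) hT).addEdge hR.sep
  · exact hT.addEdge hab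

/-- The potential between two insertions, when the settled pairs are those joined by a path. The
bound `n / √b` for close pairs balances the two summands of the potential. -/
noncomputable def graphPotential (F : Order V n) (b : ℝ) (E : V → V → Prop) (T : Order V n) : ℝ :=
  potential F b (n / √b) (Relation.TransGen E) T

lemma mul_countBoth_insertEdge_le (hp : (n : ℝ) ≤ t (p + 1)) (hi : 0 < t (i + 1))
    (hT : IsTopOrder E T) (hF : IsTopOrder (addEdge E a b) F)
    (h : insertEdge E p t depth T a b = some (T', L)) :
    t i * countBoth s i L ≤
      2 * (graphPotential F (t (i + 1)) (addEdge E a b) T' -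
        graphPotential F (t (i + 1)) E T) := by
  rcases insertEdge_eq_some h with h | ⟨-, rfl, rfl⟩
  · have hk : 0 < n / √(t (i + 1)) :=
      div_pos (Nat.cast_pos.2 (Fin.pos (T a))) (Real.sqrt_pos.2 hi)
    have hcount := (reorder_counted (s := s) (cones_edgeCone hF) hp (isWeight_potential
      (cones_edgeCone hF) (lt_of_mem_edgeCone hF) hi.le hk) h (admissible_insert hT a b)).count_le
    have hstart : graphPotential F (t (i + 1)) E T ≤
        potential F (t (i + 1)) (n / √(t (i + 1))) (Settled E (edgeCone E a b) T) T :=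
      potential_mono F T hi.le _ fun _ _ => Or.inl
    have hend : potential F (t (i + 1)) (n / √(t (i + 1))) (Settled E (edgeCone E a b) T') T' ≤
        graphPotential F (t (i + 1)) (addEdge E a b) T' :=
      potential_mono F T' hi.le _ fun _ _ => transGen_addEdge_of_settled
    linarith
  · have hmono : graphPotential F (t (i + 1)) E T' ≤
        graphPotential F (t (i + 1)) (addEdge E a b) T' :=
      potential_mono F T' hi.le _ (Relation.TransGen.mono fun _ _ => .inl)
    simpa [countBoth_nil] using hmono

lemma terminates_insertEdges (hp : (n : ℝ) ≤ t (p + 1)) (hT : IsTopOrder E T)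
    (hF : IsTopOrder (addEdges E edges) F) :
    Terminates fun depth => insertEdges p t depth E T edges := by
  induction edges generalizing E T with
  | nil => exact .const _
  | cons e edges ih =>
    rw [addEdges_cons] at hF
    have hF' : IsTopOrder (addEdge E e.1 e.2) F := hF.mono fun _ _ => .inl
    refine (terminates_insertEdge hp hT hF').bind fun depth r hr => Terminates.map ?_ _
    exact ih (isTopOrder_of_insertEdge hp hT hF' hr) hF

lemma mul_countBoth_insertEdges_le (hp : (n : ℝ) ≤ t (p + 1)) (hi : 0 < t (i + 1))
    (hT : IsTopOrder E T) (hF : IsTopOrder (addEdges E edges) F)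
    (h : insertEdges p t depth E T edges = some (T', L)) :
    t i * countBoth s i L ≤
      2 * (2 * ((n : ℝ) ^ 2 * √(t (i + 1))) - graphPotential F (t (i + 1)) E T) := by
  induction edges generalizing E T L with
  | nil =>
    cases h
    simpa [countBoth_nil, graphPotential] using potential_le F T' hi (Relation.TransGen E)
  | cons e edges ih =>
    rw [addEdges_cons] at hF
    have hF' : IsTopOrder (addEdge E e.1 e.2) F := hF.mono fun _ _ => .inl
    simp only [insertEdges, Option.bind_eq_some_iff, Option.map_eq_some_iff] at h
    obtain ⟨⟨T₁, L₁⟩, hfirst, ⟨T₂, L₂⟩, hrest, hout⟩ := h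
    cases hout
    have hfirst' := mul_countBoth_insertEdge_le (s := s) hp hi hT hF' hfirst
    have hrest' := ih (isTopOrder_of_insertEdge hp hT hF' hfirst) hF hrest
    rw [countBoth_append]
    push_cast
    linarith

lemma countBoth_insertEdges_le (hp : (n : ℝ) ≤ t (p + 1)) (hi : 0 < t i) (hi' : 0 < t (i + 1))
    (hT : IsTopOrder E T) (hF : IsTopOrder (addEdges E edges) F)
    (h : insertEdges p t depth E T edges = some (T', L)) (s : Side) :
    (countBoth s i L : ℝ) ≤ 4 * ((n : ℝ) ^ 2 * √(t (i + 1)) / t i) := by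
  have hnonneg : 0 ≤ graphPotential F (t (i + 1)) E T :=
    potential_nonneg F T hi'.le (by positivity) _
  rw [← mul_div_assoc, le_div_iff₀' hi]
  linarith [mul_countBoth_insertEdges_le (s := s) hp hi' hT hF h]

end Insertion

lemma pos_of_strictly_increasing {t : ℕ → ℝ} {m : ℕ} (h₀ : 0 < t 0)
    (ht : ∀ i, i ≤ m → t i < t (i + 1)) : ∀ i ≤ m + 1, 0 < t i := by
  intro i
  induction i with
  | zero => exact fun _ => h₀
  | succ i ih => exact fun hi => (ih (by omega)).trans (ht i (by omega))

end OnlineTopSort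

theorem mainTheorem8_general {n : ℕ} {V : Type*} [Fintype V] {p : ℕ} {t : ℕ → ℝ}
    (ht : ∀ i ≤ p + 1, 0 < t i) (hp : (n : ℝ) ≤ t (p + 1)) {E₀ : V → V → Prop}
    {T₀ : OnlineTopSort.Order V n} {edges : List (V × V)} (hT₀ : OnlineTopSort.IsTopOrder E₀ T₀)
    (hE : OnlineTopSort.Acyclic fun a b => E₀ a b ∨ (a, b) ∈ edges) :
    ∃ N : ℕ, ∀ depth, N ≤ depth →
      ∃ (T : OnlineTopSort.Order V n) (log : List (OnlineTopSort.CallRecord V)),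
        OnlineTopSort.insertEdges p t depth E₀ T₀ edges = some (T, log) ∧
        ∀ i, i ≤ p →
          (OnlineTopSort.countBothA i log : ℝ) ≤ 4 * ((n : ℝ) ^ 2 * √(t (i + 1)) / t i) ∧
          (OnlineTopSort.countBothB i log : ℝ) ≤ 4 * ((n : ℝ) ^ 2 * √(t (i + 1)) / t i) := by
  obtain ⟨F, hF⟩ := OnlineTopSort.exists_isTopOrder hE T₀
  obtain ⟨⟨T, log⟩, hrun⟩ := OnlineTopSort.terminates_insertEdges hp hT₀ hF
  obtain ⟨N, hN⟩ := Filter.eventually_atTop.1 hrun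
  refine ⟨N, fun depth hdepth => ⟨T, log, hN depth hdepth, fun i hi => ?_⟩⟩
  have hcount := OnlineTopSort.countBoth_insertEdges_le hp (ht i (by omega))
    (ht (i + 1) (by omega)) hT₀ hF (hN depth hdepth)
  exact ⟨hcount .lower, hcount .upper⟩

theorem mainTheorem8 :
    ∃ C : ℝ, 0 < C ∧
      ∀ (n : ℕ) (V : Type*) [Fintype V] (p : ℕ) (t : ℕ → ℝ),
        Real.sqrt n < t 0 →
        (∀ i, i ≤ p → t i < t (i + 1)) →
        t (p + 1) = n →
        ∀ (E₀ : V → V → Prop) (T₀ : OnlineTopSort.Order V n) (edges : List (V × V)),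
          OnlineTopSort.IsTopOrder E₀ T₀ →
          OnlineTopSort.Acyclic (fun a b => E₀ a b ∨ (a, b) ∈ edges) →
          ∃ N : ℕ, ∀ depth, N ≤ depth →
            ∃ (T : OnlineTopSort.Order V n) (log : List (OnlineTopSort.CallRecord V)),
              OnlineTopSort.insertEdges p t depth E₀ T₀ edges = some (T, log) ∧
              ∀ i, i ≤ p →
                (OnlineTopSort.countBothA i log : ℝ) ≤
                  C * ((n : ℝ) ^ 2 * Real.sqrt (t (i + 1)) / t i) ∧
                (OnlineTopSort.countBothB i log : ℝ) ≤
                  C * ((n : ℝ) ^ 2 * Real.sqrt (t (i + 1)) / t i) :=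
  ⟨4, by norm_num, fun n V _ p t ht₀ ht hp E₀ T₀ edges hT₀ hE =>
    mainTheorem8_general
      (OnlineTopSort.pos_of_strictly_increasing ((Real.sqrt_nonneg _).trans_lt ht₀) ht)
      hp.ge hT₀ hE⟩
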